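/- Let $G$ be a finite simple graph on the vertex set $V$ that is co-chordal, i.e. in the complementary graph $G^c$ every cycle of length greater than $3$ has a chord. Let $K$ be a field, let $S = K[V]$ be the polynomial ring whose variables are the vertices of $G$, with its standard $\mathbb{N}^V$-grading, and let $I(G) = (uv : \{u,v\} \in E(G)) \subset S$ be the edge ideal of $G$. Then $S/I(G)$ has a minimal $\mathbb{N}^V$-graded free resolution $$\cdots \longrightarrow \bigoplus_{\tau \in \mathbb{N}^V} S(-\tau)^{\beta_{1,\tau}} \longrightarrow \bigoplus_{\tau \in \mathbb{N}^V} S(-\tau)^{\beta_{0,\tau}} \longrightarrow S/I(G) \longrightarrow 0,$$ and for every such resolution, with graded Betti numbers $\beta_{i,\tau}(S/I(G)) = \beta_{i,\tau}$, the following holds. For every integer $i \geq 1$ and every subset $\sigma \subset V$, identified with its $(0,1)$-vector in $\mathbb{N}^V$, $$\beta_{i,\sigma}(S/I(G)) \neq 0 \quad\Longleftrightarrow\quad |\sigma| = i+1 \ \text{ and the induced subgraph } G_\sigma \text{ contains a complete bipartite graph as a spanning subgraph.}$$ Here a complete bipartite graph is a graph whose vertex set is the disjoint union of two nonempty sets $V_1$,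 $V_2$ and whose edges are exactly the pairs $\{v_1, v_2\}$ with $v_1 \in V_1$ and $v_2 \in V_2$. -/

import Mathlib

open MvPolynomial

/-- A graph is chordal if every cycle of length `> 3` has a chord, i.e. an edge of the graph that
joins two vertices of the cycle and is not an edge of the cycle. -/
def SimpleGraph.IsChordalGraph {V : Type*} (G : SimpleGraph V) : Prop :=
  ∀ (v : V) (p : G.Walk v v), p.IsCycle → 3 < p.length →
    ∃ u ∈ p.support, ∃ w ∈ p.support, G.Adj u w ∧ s(u, w) ∉ p.edges

/-- A graph is co-chordal if its complementary graph is chordal. -/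
def SimpleGraph.IsCoChordalGraph {V : Type*} (G : SimpleGraph V) : Prop :=
  Gᶜ.IsChordalGraph

/-- A complete bipartite graph: its vertex set is the disjoint union of two nonempty sets `V₁`,
`V₂`, there is no edge inside `V₁` or inside `V₂`, and every vertex of `V₁` is adjacent to every
vertex of `V₂`. -/
def SimpleGraph.IsCompleteBipartiteGraph {W : Type*} (B : SimpleGraph W) : Prop :=
  ∃ V₁ V₂ : Set W, V₁.Nonempty ∧ V₂.Nonempty ∧ Disjoint V₁ V₂ ∧ V₁ ∪ V₂ = Set.univ ∧
    (∀ u ∈ V₁, ∀ v ∈ V₁, ¬ B.Adj u v) ∧ (∀ u ∈ V₂, ∀ v ∈ V₂, ¬ B.Adj u v) ∧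
    ∀ u ∈ V₁, ∀ v ∈ V₂, B.Adj u v

/-- `G` contains a complete bipartite graph as a spanning subgraph. -/
def SimpleGraph.HasCompleteBipartiteSpanningSubgraph {W : Type*} (G : SimpleGraph W) : Prop :=
  ∃ B : G.Subgraph, B.IsSpanning ∧ B.coe.IsCompleteBipartiteGraph

/-- The edge ideal `I(G) = (u v : {u, v} ∈ E(G))` of the polynomial ring `K[V]`. -/
noncomputable def edgeIdeal (K : Type*) [Field K] {V : Type*} (G : SimpleGraph V) : Ideal (MvPolynomial V K) :=
  Ideal.span {f | ∃ u v : V, G.Adj u v ∧ f = X u * X v}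

/-- The `ℕ^V`-grading of `S / I` (for a monomial ideal `I` of `S = K[V]`): the piece of degree `τ`
is the image of `S_τ = K · x^τ`. -/
noncomputable def quotientPiece (K : Type*) [Field K] {V : Type*} (I : Ideal (MvPolynomial V K)) (τ : V →₀ ℕ) :
    Submodule K (MvPolynomial V K ⧸ I) :=
  (LinearMap.range (monomial τ : K →ₗ[K] MvPolynomial V K)).map
    (Ideal.Quotient.mkₐ K I).toLinearMap

/-- The free module `⨁_σ S(-σ)^{β σ}` over `S = K[V]`; the `β σ` basis vectors of the summand
`S(-σ)^{β σ}` are indexed by the pairs `⟨σ, k⟩` with `k : Fin (β σ)`. -/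
abbrev ShiftedFree (K : Type*) [Field K] {V : Type*} (β : (V →₀ ℕ) → ℕ) : Type _ :=
  (Σ σ : V →₀ ℕ, Fin (β σ)) →₀ MvPolynomial V K

/-- The piece of degree `τ` of `⨁_σ S(-σ)^{β σ}`: the basis vector `⟨σ, k⟩` has degree `σ`, so only
monomials `x^m` with `m + σ = τ` occur in the coordinate at `⟨σ, k⟩`. -/
def shiftedFreePiece (K : Type*) [Field K] {V : Type*} (β : (V →₀ ℕ) → ℕ) (τ : V →₀ ℕ) :
    Submodule K (ShiftedFree K β) where
  carrier := {f | ∀ (j : Σ σ : V →₀ ℕ, Fin (β σ)) (m : V →₀ ℕ), m + j.1 ≠ τ → coeff m (f j) = 0}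
  zero_mem' := by
    intro j m _
    simp
  add_mem' := by
    intro f g hf hg j m hm
    simp [hf j m hm, hg j m hm]
  smul_mem' := by
    intro c f hf j m hm
    simp [hf j m hm]

/-- A minimal `ℕ^V`-graded free resolution
`⋯ → ⨁_σ S(-σ)^{β_{1,σ}} → ⨁_σ S(-σ)^{β_{0,σ}} → M → 0`
of the `S`-module `M`, `S = K[V]`, with graded pieces `𝓜 τ`. All maps are homogeneous of degree
zero, and minimality says that the image of every differential lies in `𝔪 F_i`, where
`𝔪 = (v : v ∈ V)`, i.e. that its coordinates have constant coefficient zero. -/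
structure MinimalGradedFreeResolution (K : Type*) [Field K] {V : Type*} {M : Type*}
    [AddCommGroup M] [Module K M] [Module (MvPolynomial V K) M]
    (𝓜 : (V →₀ ℕ) → Submodule K M) where
  /-- `betti i σ` is the number of copies of `S(-σ)` in homological degree `i`. -/
  betti : ℕ → (V →₀ ℕ) → ℕ
  /-- the differential `F_{i+1} → F_i` -/
  d : ∀ i : ℕ, ShiftedFree K (betti (i + 1)) →ₗ[MvPolynomial V K] ShiftedFree K (betti i)
  /-- the augmentation `F_0 → M` -/
  ε : ShiftedFree K (betti 0) →ₗ[MvPolynomial V K] M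
  d_graded : ∀ (i : ℕ) (τ : V →₀ ℕ), ∀ f ∈ shiftedFreePiece K (betti (i + 1)) τ,
    d i f ∈ shiftedFreePiece K (betti i) τ
  ε_graded : ∀ τ : V →₀ ℕ, ∀ f ∈ shiftedFreePiece K (betti 0) τ, ε f ∈ 𝓜 τ
  ε_surjective : Function.Surjective ε
  exact_zero : Function.Exact (d 0) ε
  exact_succ : ∀ i : ℕ, Function.Exact (d (i + 1)) (d i)
  minimal : ∀ (i : ℕ) (f : ShiftedFree K (betti (i + 1))) (j : Σ σ : V →₀ ℕ, Fin (betti i σ)),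
    constantCoeff (d i f j) = 0

/-- The `(0,1)`-vector in `ℕ^V` of a subset of `V`. -/
noncomputable def zeroOneVector {V : Type*} (σ : Finset V) : V →₀ ℕ :=
  Finsupp.indicator σ fun _ _ => 1

/-! Betti numbers are read off from Koszul cohomology, a hands-on form of computing Tor(S/I(G), K)
in two ways. For a graded module M the strand of degree σ of the Koszul complex, indexed by
complements of faces, has in degree n the sum of the M_B with B ⊆ σ, |B| = n; its differential adds
a vertex v to B through multiplication by x_v. On S(-τ) this strand is exact, except in degree |σ|
when τ = σ. On M the cohomology in degree |σ| is M_σ / Σ x_v M_{σ∖v}, which detects minimal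
generators of degree σ (`hasKoszulCohomology_card_iff`). Dimension shifting along a minimal
resolution (`hasKoszulCohomology_iff_succ`) moves the cohomology of S/I(G) in degree |σ| - i up to
degree |σ| of the syzygy module covered by F_i, so it is nonzero iff β_{i,σ} ≠ 0.

The piece (S/I(G))_B is K if B is independent and 0 otherwise. The strand of S/I(G) is therefore the
augmented cochain complex of the independence complex of G_σ, with H̃^{n-1} in degree n (Hochster's
formula, `hasKoszulCohomology_edgeIdeal_iff`). This complex is the clique complex of a chordal
graph. By Dirac's theorem (`IsChordalGraph.exists_simplicial`) it is built by adding vertices whose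
link is empty or a simplex, so its cohomology vanishes for n ≥ 2. For n ≤ 0 it vanishes because σ is
nonempty or no B has that size. Only n = 1, that is |σ| = i + 1, remains: H̃^0 ≠ 0 says that the
complement of G_σ is disconnected, i.e. that σ splits into two nonempty parts with all cross pairs
edges of G.

For existence, a graded submodule N is covered by lifting bases of N/𝔪N degree by degree
(`exists_minimal_cover`), and the construction is iterated on kernels. -/

/-! ### Signs and the Koszul differential -/

/-- The sign `(-1) ^ #{u ∈ B | u < v}`. -/
def koszulSign (R : Type*) [CommRing R] {V : Type*} [LinearOrder V] (v : V) (B : Finset V) : R :=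
  (-1) ^ (B.filter (· < v)).card

theorem koszulSign_eq_or (R : Type*) [CommRing R] {V : Type*} [LinearOrder V] (v : V)
    (B : Finset V) : koszulSign R v B = 1 ∨ koszulSign R v B = -1 :=
  neg_one_pow_eq_or R _

theorem koszulSign_mul_self (R : Type*) [CommRing R] {V : Type*} [LinearOrder V] (v : V)
    (B : Finset V) : koszulSign R v B * koszulSign R v B = 1 := by
  rcases koszulSign_eq_or R v B with h | h <;> simp [h]

theorem koszulSign_mul_erase_of_lt (R : Type*) [CommRing R] {V : Type*} [LinearOrder V] {u v : V}
    {B : Finset V} (hu : u ∈ B) (h : u < v) :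
    koszulSign R v B * koszulSign R u (B.erase v) =
      -(koszulSign R u B * koszulSign R v (B.erase u)) := by
  have h1 : (B.erase v).filter (· < u) = B.filter (· < u) := by
    ext w
    simp only [Finset.mem_filter, Finset.mem_erase]
    constructor
    · rintro ⟨⟨_, hw⟩, hwu⟩
      exact ⟨hw, hwu⟩
    · rintro ⟨hw, hwu⟩
      exact ⟨⟨(hwu.trans h).ne, hw⟩, hwu⟩
  have h2 : (B.erase u).filter (· < v) = (B.filter (· < v)).erase u := by
    ext w
    simp only [Finset.mem_filter, Finset.mem_erase]
    tauto
  have h3 : ((B.filter (· < v)).erase u).card + 1 = (B.filter (· < v)).card :=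
    Finset.card_erase_add_one (by simp [hu, h])
  unfold koszulSign
  rw [h1, h2, ← h3]
  ring

theorem koszulSign_mul_erase (R : Type*) [CommRing R] {V : Type*} [LinearOrder V] {u v : V}
    {B : Finset V} (hu : u ∈ B) (hv : v ∈ B) (h : u ≠ v) :
    koszulSign R v B * koszulSign R u (B.erase v) =
      -(koszulSign R u B * koszulSign R v (B.erase u)) := by
  rcases lt_or_gt_of_ne h with h | h
  · exact koszulSign_mul_erase_of_lt R hu h
  · rw [koszulSign_mul_erase_of_lt R hv h, neg_neg]

/-- The Koszul differential of the elements `x v`, written on the complements of the faces. -/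
def koszulDiff {R : Type*} [CommRing R] {V : Type*} [LinearOrder V] {M : Type*} [AddCommGroup M]
    [Module R M] (x : V → R) (z : Finset V → M) (B : Finset V) : M :=
  ∑ v ∈ B, (koszulSign R v B * x v) • z (B.erase v)

section koszul

variable {R : Type*} [CommRing R] {V : Type*} [LinearOrder V] {M : Type*} [AddCommGroup M]
  [Module R M] {E : Type*} [AddCommGroup E] [Module R E]

theorem koszulDiff_sub (x : V → R) (z w : Finset V → M) (B : Finset V) :
    koszulDiff x (fun A => z A - w A) B = koszulDiff x z B - koszulDiff x w B := by
  simp [koszulDiff, smul_sub, Finset.sum_sub_distrib]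

theorem koszulDiff_add (x : V → R) (z w : Finset V → M) (B : Finset V) :
    koszulDiff x (fun A => z A + w A) B = koszulDiff x z B + koszulDiff x w B := by
  simp [koszulDiff, smul_add, Finset.sum_add_distrib]

theorem koszulDiff_map (x : V → R) (φ : E →ₗ[R] M) (z : Finset V → E) (B : Finset V) :
    koszulDiff x (fun A => φ (z A)) B = φ (koszulDiff x z B) := by
  simp [koszulDiff, map_sum]

theorem koszulDiff_congr (x : V → R) {z w : Finset V → M} {B : Finset V}
    (h : ∀ v ∈ B, z (B.erase v) = w (B.erase v)) : koszulDiff x z B = koszulDiff x w B :=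
  Finset.sum_congr rfl fun v hv => by rw [h v hv]

/-- The terms for (v, u) and (u, v) cancel by the sign rule `koszulSign_mul_erase`. -/
theorem koszulDiff_koszulDiff (x : V → R) (z : Finset V → M) (B : Finset V) :
    koszulDiff x (koszulDiff x z) B = 0 := by
  unfold koszulDiff
  simp_rw [Finset.smul_sum]
  rw [Finset.sum_sigma']
  refine Finset.sum_involution (fun p _ => ⟨p.2, p.1⟩) ?_ ?_ ?_ ?_
  · rintro ⟨v, u⟩ h
    simp only [Finset.mem_sigma, Finset.mem_erase] at h
    obtain ⟨hv, huv, hu⟩ := h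
    have h1 := koszulSign_mul_erase R hu hv huv
    simp only [Finset.erase_right_comm (a := u) (b := v), smul_smul]
    rw [← add_smul]
    have : koszulSign R v B * x v * (koszulSign R u (B.erase v) * x u) +
        koszulSign R u B * x u * (koszulSign R v (B.erase u) * x v) = 0 := by
      linear_combination (x u * x v) * h1
    rw [this, zero_smul]
  · rintro ⟨v, u⟩ h _ heq
    simp only [Finset.mem_sigma, Finset.mem_erase] at h
    simp only [Sigma.mk.injEq] at heq
    exact h.2.1 heq.1
  · rintro ⟨v, u⟩ h
    simp only [Finset.mem_sigma, Finset.mem_erase] at h ⊢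
    exact ⟨h.2.2, Ne.symm h.2.1, h.1⟩
  · rintro ⟨v, u⟩ h
    rfl

/-- The signs are ±1, so additive subgroups suffice; graded pieces are not R-submodules. -/
theorem koszulDiff_mem (x : V → R) {𝓜 : Finset V → AddSubgroup M} {z : Finset V → M}
    {B : Finset V} (h𝓜 : ∀ v ∈ B, ∀ m ∈ 𝓜 (B.erase v), x v • m ∈ 𝓜 B)
    (hz : ∀ v ∈ B, z (B.erase v) ∈ 𝓜 (B.erase v)) : koszulDiff x z B ∈ 𝓜 B := by
  refine sum_mem fun v hv => ?_
  rw [mul_smul]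
  rcases koszulSign_eq_or R v B with h | h
  · simpa [h] using h𝓜 v hv _ (hz v hv)
  · simpa [h] using h𝓜 v hv _ (hz v hv)

/-- The contracting homotopy `h` of the Koszul complex given by division by `x v`: the faces that
contain `v`. -/
theorem koszulDiff_contraction_of_mem (x : V → R) {z h : Finset V → M} {v : V} {B : Finset V}
    (hv : v ∈ B) (h0 : ∀ u ∈ B, u ≠ v → h (B.erase u) = 0)
    (h1 : x v • h (B.erase v) = koszulSign R v B • z B) : koszulDiff x h B = z B := by
  unfold koszulDiff
  rw [Finset.sum_eq_single v]
  · rw [mul_smul, h1, smul_smul, koszulSign_mul_self, one_smul]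
  · intro u hu huv
    rw [h0 u hu huv, smul_zero]
  · exact fun h => absurd hv h

/-- The contracting homotopy `h` of the Koszul complex given by division by `x v`: the faces that
do not contain `v`. -/
theorem koszulDiff_contraction_of_notMem (x : V → R) {z h : Finset V → M} {v : V} {B : Finset V}
    (hv : v ∉ B) (hz : koszulDiff x z (insert v B) = 0)
    (h1 : ∀ u ∈ B, x v • h (B.erase u) =
      koszulSign R v (insert v (B.erase u)) • z (insert v (B.erase u))) :
    x v • koszulDiff x h B = x v • z B := by
  unfold koszulDiff at hz ⊢
  rw [Finset.sum_insert hv, Finset.erase_insert hv] at hz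
  have key : ∀ u ∈ B, x v • ((koszulSign R u B * x u) • h (B.erase u)) =
      (-koszulSign R v (insert v B)) •
        ((koszulSign R u (insert v B) * x u) • z ((insert v B).erase u)) := by
    intro u hu
    have huv : u ≠ v := fun h => hv (h ▸ hu)
    have h2 := koszulSign_mul_erase R (Finset.mem_insert_of_mem hu) (Finset.mem_insert_self v B) huv
    rw [Finset.erase_insert hv] at h2
    rw [smul_comm, h1 u hu, Finset.erase_insert_of_ne huv.symm, smul_smul, smul_smul]
    rw [Finset.erase_insert_of_ne huv.symm] at h2
    congr 1
    have h3 := koszulSign_mul_self R v (insert v B)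
    have h4 := koszulSign_mul_self R v (insert v (B.erase u))
    linear_combination (-x u * koszulSign R v (insert v (B.erase u)) * koszulSign R u B) * h3 +
      (x u * koszulSign R v (insert v B) * koszulSign R v (insert v (B.erase u))) * h2 -
      (x u * koszulSign R v (insert v B) * koszulSign R u (insert v B)) * h4
  rw [Finset.smul_sum, Finset.sum_congr rfl key, ← Finset.smul_sum,
    eq_neg_of_add_eq_zero_right hz, neg_smul, smul_neg, neg_neg, smul_smul, ← mul_assoc,
    koszulSign_mul_self, one_mul]

/-! ### Cohomology of a strand and dimension shifting -/

/-- `z` is a cocycle of degree `n` in the strand `σ` of the Koszul complex. -/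
def IsKoszulCocycle (x : V → R) (σ : Finset V) (n : ℤ) (𝓜 : Finset V → AddSubgroup M)
    (z : Finset V → M) : Prop :=
  (∀ B ⊆ σ, (B.card : ℤ) = n → z B ∈ 𝓜 B) ∧
    ∀ B ⊆ σ, (B.card : ℤ) = n + 1 → koszulDiff x z B = 0

/-- `z` is a coboundary of degree `n` in the strand `σ` of the Koszul complex. -/
def IsKoszulCoboundary (x : V → R) (σ : Finset V) (n : ℤ) (𝓜 : Finset V → AddSubgroup M)
    (z : Finset V → M) : Prop :=
  ∃ w : Finset V → M, (∀ B ⊆ σ, (B.card : ℤ) + 1 = n → w B ∈ 𝓜 B) ∧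
    ∀ B ⊆ σ, (B.card : ℤ) = n → koszulDiff x w B = z B

/-- The Koszul complex has nonzero cohomology of degree `n` in the strand `σ`. -/
def HasKoszulCohomology (x : V → R) (σ : Finset V) (n : ℤ) (𝓜 : Finset V → AddSubgroup M) : Prop :=
  ∃ z, IsKoszulCocycle x σ n 𝓜 z ∧ ¬ IsKoszulCoboundary x σ n 𝓜 z

theorem card_erase_cast {v : V} {B : Finset V} (hv : v ∈ B) :
    ((B.erase v).card : ℤ) + 1 = B.card := by
  exact_mod_cast Finset.card_erase_add_one hv

/-- Dimension shifting. -/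
theorem hasKoszulCohomology_iff_ker (x : V → R) (σ : Finset V) (n : ℤ) (φ : E →ₗ[R] M)
    {ℰ : Finset V → AddSubgroup E} {𝓜 : Finset V → AddSubgroup M}
    (hℰ : ∀ B, ∀ v ∈ B, ∀ m ∈ ℰ (B.erase v), x v • m ∈ ℰ B)
    (hφ : ∀ B, ∀ e ∈ ℰ B, φ e ∈ 𝓜 B) (hsurj : ∀ B, ∀ m ∈ 𝓜 B, ∃ e ∈ ℰ B, φ e = m)
    (h1 : ∀ z, IsKoszulCocycle x σ n ℰ z → IsKoszulCoboundary x σ n ℰ z)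
    (h2 : ∀ z, IsKoszulCocycle x σ (n + 1) (fun B => ℰ B ⊓ φ.toAddMonoidHom.ker) z →
      IsKoszulCoboundary x σ (n + 1) ℰ z) :
    HasKoszulCohomology x σ n 𝓜 ↔
      HasKoszulCohomology x σ (n + 1) (fun B => ℰ B ⊓ φ.toAddMonoidHom.ker) := by
  have hlift : ∀ (k : ℤ) (z : Finset V → M),
      (∀ B ⊆ σ, (B.card : ℤ) = k → z B ∈ 𝓜 B) →
      ∃ y : Finset V → E, ∀ B ⊆ σ, (B.card : ℤ) = k → y B ∈ ℰ B ∧ φ (y B) = z B := by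
    intro k z hz
    have : ∀ B, ∃ e, B ⊆ σ → (B.card : ℤ) = k → e ∈ ℰ B ∧ φ e = z B := by
      intro B
      by_cases h : B ⊆ σ ∧ (B.card : ℤ) = k
      · obtain ⟨e, he⟩ := hsurj B _ (hz B h.1 h.2)
        exact ⟨e, fun _ _ => he⟩
      · exact ⟨0, fun a b => absurd ⟨a, b⟩ h⟩
    choose y hy using this
    exact ⟨y, hy⟩
  have hdiff : ∀ (k : ℤ) (y : Finset V → E), (∀ B ⊆ σ, (B.card : ℤ) = k → y B ∈ ℰ B) →
      ∀ B ⊆ σ, (B.card : ℤ) = k + 1 → koszulDiff x y B ∈ ℰ B := by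
    intro k y hy B hB hk
    refine koszulDiff_mem x (hℰ B) fun v hv => hy _ ((Finset.erase_subset _ _).trans hB) ?_
    have := card_erase_cast hv
    omega
  constructor
  · rintro ⟨z, ⟨hz, hz'⟩, hnb⟩
    -- The connecting homomorphism: lift z through φ and differentiate the lift.
    obtain ⟨y, hy⟩ := hlift n z hz
    refine ⟨koszulDiff x y, ⟨fun B hB hn => ⟨hdiff n y (fun B hB h => (hy B hB h).1) B hB hn, ?_⟩,
      fun B _ _ => koszulDiff_koszulDiff x y B⟩, ?_⟩
    · change φ (koszulDiff x y B) = 0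
      rw [← koszulDiff_map, ← hz' B hB hn]
      refine koszulDiff_congr x fun v hv => (hy _ ((Finset.erase_subset _ _).trans hB) ?_).2
      have := card_erase_cast hv
      omega
    · rintro ⟨w, hw, hwy⟩
      -- If the differential of y equals that of w in degree n + 1, with w in the kernel, then y - w
      -- is a cocycle of ℰ, hence exact, and φ carries its primitive to one of z.
      obtain ⟨u, hu, huy⟩ := h1 (fun B => y B - w B) ⟨fun B hB hn =>
        sub_mem (hy B hB hn).1 (hw B hB (by omega)).1, fun B hB hn => by
          rw [koszulDiff_sub, hwy B hB hn, sub_self]⟩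
      refine hnb ⟨fun B => φ (u B), fun B hB hn => hφ B _ (hu B hB hn), fun B hB hn => ?_⟩
      rw [koszulDiff_map, huy B hB hn, map_sub, (hy B hB hn).2]
      have : φ (w B) = 0 := (hw B hB (by omega)).2
      rw [this, sub_zero]
  · rintro ⟨z, hz, hnb⟩
    -- Conversely a kernel cocycle has a primitive y in ℰ, whose image φ y is the required class. A
    -- primitive of φ y lifts to u, and y corrected by the differential of u lies in the kernel.
    obtain ⟨y, hy, hyz⟩ := h2 z hz
    refine ⟨fun B => φ (y B), ⟨fun B hB hn => hφ B _ (hy B hB (by omega)), fun B hB hn => ?_⟩, ?_⟩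
    · rw [koszulDiff_map, hyz B hB hn]
      exact (hz.1 B hB hn).2
    · rintro ⟨w, hw, hwy⟩
      obtain ⟨u, hu⟩ := hlift (n - 1) w (fun B hB hn => hw B hB (by omega))
      refine hnb ⟨fun B => y B - koszulDiff x u B, fun B hB hn => ⟨?_, ?_⟩, fun B hB hn => ?_⟩
      · exact (ℰ B).sub_mem (hy B hB hn)
          (hdiff (n - 1) u (fun B hB h => (hu B hB h).1) B hB (by omega))
      · have hw' : koszulDiff x w B = φ (y B) := hwy B hB (by omega)
        change φ (y B - koszulDiff x u B) = 0
        rw [map_sub, ← koszulDiff_map, ← hw', sub_eq_zero]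
        refine koszulDiff_congr x fun v hv => ((hu _ ((Finset.erase_subset _ _).trans hB) ?_).2).symm
        have := card_erase_cast hv
        omega
      · rw [koszulDiff_sub, hyz B hB hn]
        rw [koszulDiff_koszulDiff, sub_zero]

end koszul

/-! ### Koszul strands of graded free modules -/

theorem zeroOneVector_apply {V : Type*} [DecidableEq V] (σ : Finset V) (v : V) :
    zeroOneVector σ v = if v ∈ σ then 1 else 0 := by
  simp [zeroOneVector, Finsupp.indicator_apply]

theorem zeroOneVector_insert {V : Type*} [DecidableEq V] {v : V} {B : Finset V} (hv : v ∉ B) :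
    zeroOneVector (insert v B) = Finsupp.single v 1 + zeroOneVector B := by
  ext u
  simp only [zeroOneVector_apply, Finsupp.add_apply, Finsupp.single_apply, Finset.mem_insert]
  by_cases h : u = v
  · subst h
    simp [hv]
  · simp [h, Ne.symm h]

theorem zeroOneVector_erase {V : Type*} [DecidableEq V] {v : V} {B : Finset V} (hv : v ∈ B) :
    Finsupp.single v 1 + zeroOneVector (B.erase v) = zeroOneVector B := by
  rw [← zeroOneVector_insert (Finset.notMem_erase v B), Finset.insert_erase hv]

/-- Acyclicity of the strands of the Koszul complex of `S(-τ)`, away from the top degree. -/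
theorem exists_koszulDiff_eq_of_coordinate {K : Type*} [Field K] {V : Type*} [LinearOrder V]
    (σ : Finset V) (n : ℤ) (τ : V →₀ ℕ) (f : Finset V → MvPolynomial V K)
    (hf : ∀ B ⊆ σ, (B.card : ℤ) = n → ∀ m, m + τ ≠ zeroOneVector B → coeff m (f B) = 0)
    (hf' : ∀ B ⊆ σ, (B.card : ℤ) = n + 1 → koszulDiff (X : V → MvPolynomial V K) f B = 0)
    (hc : n = σ.card → τ = zeroOneVector σ → constantCoeff (f σ) = 0) :
    ∃ g : Finset V → MvPolynomial V K,
      (∀ B ⊆ σ, (B.card : ℤ) + 1 = n → ∀ m, m + τ ≠ zeroOneVector B → coeff m (g B) = 0) ∧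
        ∀ B ⊆ σ, (B.card : ℤ) = n → koszulDiff (X : V → MvPolynomial V K) g B = f B := by
  by_cases h : ∃ v ∈ σ, τ v = 0
  · obtain ⟨v, hvσ, hv⟩ := h
    -- As τ v = 0, every monomial of f B is divisible by x_v once v ∈ B; division by x_v then gives
    -- a contracting homotopy.
    have hdiv : ∀ B ⊆ σ, (B.card : ℤ) = n → v ∈ B →
        X v * (f B).divMonomial (Finsupp.single v 1) = f B := by
      intro B hB hn hvB
      have hX : X v ∣ f B := by
        rw [X_dvd_iff_modMonomial_eq_zero]
        ext m
        by_cases hm : Finsupp.single v 1 ≤ m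
        · rw [coeff_modMonomial_of_le _ hm, coeff_zero]
        · rw [coeff_modMonomial_of_not_le _ hm, coeff_zero]
          refine hf B hB hn m fun hmB => hm ?_
          have := DFunLike.congr_fun hmB v
          rw [Finsupp.add_apply, hv, zeroOneVector_apply, if_pos hvB] at this
          rw [Finsupp.single_le_iff]
          omega
      obtain ⟨q, hq⟩ := hX
      rw [hq, X_mul_divMonomial]
    set g : Finset V → MvPolynomial V K := fun B => if v ∈ B then 0 else
      koszulSign (MvPolynomial V K) v (insert v B) • (f (insert v B)).divMonomial (Finsupp.single v 1) with hg
    have hgpos : ∀ B, v ∈ B → g B = 0 := fun B h => if_pos h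
    have hgneg : ∀ B, v ∉ B → g B =
      koszulSign (MvPolynomial V K) v (insert v B) • (f (insert v B)).divMonomial (Finsupp.single v 1) :=
      fun B h => if_neg h
    refine ⟨g, fun B hB hn m hm => ?_, fun B hB hn => ?_⟩
    · by_cases hvB : v ∈ B
      · rw [hgpos B hvB, coeff_zero]
      · have : coeff m ((f (insert v B)).divMonomial (Finsupp.single v 1)) = 0 := by
          rw [coeff_divMonomial]
          refine hf _ (Finset.insert_subset hvσ hB) ?_ _ ?_
          · rw [Finset.card_insert_of_notMem hvB]
            push_cast
            omega
          · rw [zeroOneVector_insert hvB, add_assoc]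
            exact fun h => hm (add_left_cancel h)
        rw [hgneg B hvB]
        rcases koszulSign_eq_or (MvPolynomial V K) v (insert v B) with h | h <;>
          simp [h, this]
    · by_cases hvB : v ∈ B
      · refine koszulDiff_contraction_of_mem X hvB
          (fun u _ huv => hgpos _ (Finset.mem_erase.2 ⟨huv.symm, hvB⟩)) ?_
        rw [hgneg _ (Finset.notMem_erase v B), Finset.insert_erase hvB, smul_comm, smul_eq_mul (X v),
          hdiv B hB hn hvB]
      · have hcard : ((insert v B).card : ℤ) = n + 1 := by
          rw [Finset.card_insert_of_notMem hvB]
          push_cast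
          omega
        have hsub := Finset.insert_subset hvσ hB
        have := koszulDiff_contraction_of_notMem (h := g) X hvB (hf' _ hsub hcard) ?_
        · exact mul_left_cancel₀ (X_ne_zero v) this
        · intro u hu
          have huv : u ≠ v := fun h => hvB (h ▸ hu)
          have hvu : v ∉ B.erase u := fun h => hvB (Finset.mem_of_mem_erase h)
          rw [hgneg _ hvu, smul_comm, smul_eq_mul (X v), hdiv]
          · exact Finset.insert_subset hvσ ((Finset.erase_subset _ _).trans hB)
          · rw [Finset.card_insert_of_notMem hvu]
            have := card_erase_cast hu
            push_cast
            omega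
          · exact Finset.mem_insert_self _ _
  -- Now τ ≥ 1 on σ, so m + τ = B forces B = σ and m = 0: only a constant in the top degree could
  -- survive, and `hc` excludes it.
  · push Not at h
    refine ⟨0, fun B _ _ m _ => by simp, fun B hB hn => ?_⟩
    have : koszulDiff (X : V → MvPolynomial V K) (0 : Finset V → MvPolynomial V K) B = 0 := by
      simp [koszulDiff]
    rw [this]
    symm
    ext m
    rw [coeff_zero]
    by_contra hne
    have hm : m + τ = zeroOneVector B := by
      by_contra hm
      exact hne (hf B hB hn m hm)
    have hBσ : B = σ := by
      refine Finset.Subset.antisymm hB fun v hv => ?_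
      have h1 := DFunLike.congr_fun hm v
      rw [Finsupp.add_apply, zeroOneVector_apply] at h1
      by_contra hvB
      rw [if_neg hvB] at h1
      exact h v hv (by omega)
    subst hBσ
    have hm0 : m = 0 := by
      ext v
      have h1 := DFunLike.congr_fun hm v
      rw [Finsupp.add_apply, zeroOneVector_apply] at h1
      by_cases hv : v ∈ B
      · have := h v hv
        rw [if_pos hv] at h1
        simp
        omega
      · rw [if_neg hv] at h1
        simp
        omega
    subst hm0
    rw [zero_add] at hm
    exact hne (hc hn.symm hm)

/-- The pieces of squarefree degree of `⨁_σ S(-σ)^{β σ}`. -/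
noncomputable def squarefreePiece (K : Type*) [Field K] {V : Type*} (β : (V →₀ ℕ) → ℕ) (B : Finset V) :
    AddSubgroup (ShiftedFree K β) :=
  (shiftedFreePiece K β (zeroOneVector B)).toAddSubgroup

theorem koszulDiff_apply {K : Type*} [Field K] {V : Type*} [LinearOrder V]
    {β : (V →₀ ℕ) → ℕ} (z : Finset V → ShiftedFree K β) (B : Finset V)
    (j : Σ σ : V →₀ ℕ, Fin (β σ)) :
    koszulDiff (X : V → MvPolynomial V K) z B j = koszulDiff (X : V → MvPolynomial V K) (fun A => z A j) B := by
  simp [koszulDiff, Finsupp.finsetSum_apply]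

theorem X_smul_mem_squarefreePiece {K : Type*} [Field K] {V : Type*} [LinearOrder V]
    (β : (V →₀ ℕ) → ℕ) (B : Finset V) (v : V) (hv : v ∈ B) (m : ShiftedFree K β)
    (hm : m ∈ squarefreePiece K β (B.erase v)) :
    (X v : MvPolynomial V K) • m ∈ squarefreePiece K β B := by
  intro j k hk
  rw [Finsupp.smul_apply, smul_eq_mul, coeff_X_mul']
  split_ifs with h
  · refine hm j _ fun h1 => hk ?_
    rw [← zeroOneVector_erase hv, ← h1, ← add_assoc]
    congr 1
    rw [add_comm]
    refine (Finsupp.sub_add_single_one_cancel ?_).symm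
    simpa using h
  · rfl

/-- The strand splits over the basis of the free module; the sole obstruction is a constant
coefficient at a basis vector of degree σ in the top degree. -/
theorem isKoszulCoboundary_squarefreePiece {K : Type*} [Field K] {V : Type*} [Finite V]
    [LinearOrder V] {β : (V →₀ ℕ) → ℕ} {σ : Finset V} {n : ℤ} {z : Finset V → ShiftedFree K β}
    (hz : IsKoszulCocycle (X : V → MvPolynomial V K) σ n (squarefreePiece K β) z)
    (hc : n = σ.card → ∀ j, j.1 = zeroOneVector σ → constantCoeff (z σ j) = 0) :
    IsKoszulCoboundary (X : V → MvPolynomial V K) σ n (squarefreePiece K β) z := by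
  classical
  have := Fintype.ofFinite V
  -- The last clause makes the chosen primitive zero wherever z vanishes, so that the coordinates
  -- assemble to elements of finite support.
  have key : ∀ j : Σ σ : V →₀ ℕ, Fin (β σ), ∃ g : Finset V → MvPolynomial V K,
      (∀ B ⊆ σ, (B.card : ℤ) + 1 = n → ∀ m, m + j.1 ≠ zeroOneVector B → coeff m (g B) = 0) ∧
        (∀ B ⊆ σ, (B.card : ℤ) = n → koszulDiff (X : V → MvPolynomial V K) g B = z B j) ∧
          ((∀ B, z B j = 0) → ∀ B, g B = 0) := by
    intro j
    by_cases h0 : ∀ B, z B j = 0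
    · exact ⟨0, fun B _ _ m _ => by simp, fun B _ _ => by simp [koszulDiff, h0], fun _ B => rfl⟩
    · obtain ⟨g, hg, hg'⟩ := exists_koszulDiff_eq_of_coordinate σ n j.1 (fun B => z B j)
        (fun B hB hn m hm => hz.1 B hB hn j m hm)
        (fun B hB hn => by rw [← koszulDiff_apply, hz.2 B hB hn, Finsupp.zero_apply])
        (fun hn hj => hc hn j hj)
      exact ⟨g, hg, hg', fun h => absurd h h0⟩
  choose g hg hg' hg0 using key
  refine ⟨fun B => Finsupp.onFinset (Finset.univ.biUnion fun A => (z A).support)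
    (fun j => g j B) ?_, fun B hB hn j m hm => hg j B hB hn m hm, fun B hB hn => ?_⟩
  · intro j hj
    by_contra hnot
    refine hj (hg0 j (fun A => ?_) B)
    by_contra hA
    exact hnot (Finset.mem_biUnion.2 ⟨A, Finset.mem_univ _, Finsupp.mem_support_iff.2 hA⟩)
  · ext1 j
    rw [koszulDiff_apply, ← hg' j B hB hn]
    rfl

theorem constantCoeff_koszulDiff_X {K : Type*} [Field K] {V : Type*} [LinearOrder V]
    {β : (V →₀ ℕ) → ℕ} (z : Finset V → ShiftedFree K β) (B : Finset V)
    (j : Σ σ : V →₀ ℕ, Fin (β σ)) :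
    constantCoeff (koszulDiff (X : V → MvPolynomial V K) z B j) = 0 := by
  rw [koszulDiff_apply, koszulDiff, map_sum]
  exact Finset.sum_eq_zero fun v _ => by simp

/-- The top cohomology of the strand `σ` detects the minimal generators of degree `σ`. -/
theorem hasKoszulCohomology_card_iff {K : Type*} [Field K] {V : Type*} [Finite V]
    [LinearOrder V] {M : Type*} [AddCommGroup M] [Module (MvPolynomial V K) M]
    (σ : Finset V) {β : (V →₀ ℕ) → ℕ} (φ : ShiftedFree K β →ₗ[MvPolynomial V K] M)
    {𝓜 : Finset V → AddSubgroup M} (hφ : ∀ B, ∀ e ∈ squarefreePiece K β B, φ e ∈ 𝓜 B)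
    (hsurj : ∀ B, ∀ m ∈ 𝓜 B, ∃ e ∈ squarefreePiece K β B, φ e = m)
    (hmin : ∀ f, φ f = 0 → ∀ j, constantCoeff (f j) = 0) :
    HasKoszulCohomology (X : V → MvPolynomial V K) σ σ.card 𝓜 ↔ β (zeroOneVector σ) ≠ 0 := by
  have heq : ∀ B ⊆ σ, (B.card : ℤ) = σ.card → B = σ := fun B hB hn =>
    Finset.eq_of_subset_of_card_le hB (by omega)
  constructor
  · rintro ⟨z, ⟨hz, hz'⟩, hnb⟩ hβ
    obtain ⟨e, he, hez⟩ := hsurj σ _ (hz σ subset_rfl rfl)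
    -- Only B = σ matters in the top degree, so a constant family serves as cocycle. Without basis
    -- vectors of degree σ there is no obstruction to its exactness.
    obtain ⟨u, hu, hue⟩ : IsKoszulCoboundary (X : V → MvPolynomial V K) σ σ.card
        (squarefreePiece K β) (fun _ => e) := by
      refine isKoszulCoboundary_squarefreePiece ⟨fun B hB hn => ?_, fun B hB hn => ?_⟩ ?_
      · rwa [heq B hB hn]
      · have := Finset.card_le_card hB
        omega
      · rintro - ⟨τ, k⟩ rfl
        exact absurd k.2 (by simp [hβ])
    refine hnb ⟨fun B => φ (u B), fun B hB hn => hφ B _ (hu B hB hn), fun B hB hn => ?_⟩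
    rw [koszulDiff_map, hue B hB hn, hez, heq B hB hn]
  · intro hβ
    let j : Σ σ : V →₀ ℕ, Fin (β σ) := ⟨zeroOneVector σ, ⟨0, Nat.pos_of_ne_zero hβ⟩⟩
    have he : Finsupp.single j 1 ∈ squarefreePiece K β σ := by
      classical
      intro k m hm
      rw [Finsupp.single_apply]
      split_ifs with h
      · subst h
        rw [coeff_one, if_neg]
        rintro rfl
        exact hm (zero_add _)
      · rw [coeff_zero]
    refine ⟨fun _ => φ (Finsupp.single j 1), ⟨fun B hB hn => ?_, fun B hB hn => ?_⟩, ?_⟩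
    · rw [heq B hB hn]
      exact hφ σ _ he
    · have := Finset.card_le_card hB
      omega
    · rintro ⟨w, hw, hwe⟩
      have : ∀ B, ∃ e, B ⊆ σ → (B.card : ℤ) + 1 = σ.card → φ e = w B := by
        intro B
        by_cases h : B ⊆ σ ∧ (B.card : ℤ) + 1 = σ.card
        · obtain ⟨e, -, he⟩ := hsurj B _ (hw B h.1 h.2)
          exact ⟨e, fun _ _ => he⟩
        · exact ⟨0, fun a b => absurd ⟨a, b⟩ h⟩
      choose u hu using this
      -- A primitive would put the basis vector j, minus an element of 𝔪F, into the kernel; its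
      -- constant coefficient at j is 1, against minimality.
      have h0 : φ (Finsupp.single j 1 - koszulDiff (X : V → MvPolynomial V K) u σ) = 0 := by
        rw [map_sub, ← koszulDiff_map, sub_eq_zero]
        refine (hwe σ subset_rfl rfl).symm.trans ?_
        exact koszulDiff_congr X fun v hv => (hu _ (Finset.erase_subset _ _)
          (card_erase_cast hv)).symm
      have := hmin _ h0 j
      rw [Finsupp.sub_apply, map_sub, constantCoeff_koszulDiff_X] at this
      simp at this

/-! ### Projections onto graded pieces -/

/-- The maps `p τ` are the projections onto the pieces of a grading `𝓜`. -/
structure IsGradedProjection {K ι M : Type*} [Field K] [AddCommGroup M] [Module K M]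
    (𝓜 : ι → Submodule K M) (p : ι → M →ₗ[K] M) : Prop where
  mem : ∀ τ m, p τ m ∈ 𝓜 τ
  self : ∀ τ, ∀ m ∈ 𝓜 τ, p τ m = m
  ne : ∀ τ τ', τ' ≠ τ → ∀ m ∈ 𝓜 τ', p τ m = 0
  iSup_eq_top : ⨆ τ, 𝓜 τ = ⊤

/-- Homogeneous elements span, so it is enough to check those. Only additivity of φ is asked,
because the K- and S-module structures on a resolved module are not assumed compatible. -/
theorem IsGradedProjection.map_comm {K ι M N : Type*} [Field K] [AddCommGroup M] [Module K M]
    [AddCommGroup N] [Module K N] {𝓜 : ι → Submodule K M} {p : ι → M →ₗ[K] M}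
    {𝓝 : ι → Submodule K N} {q : ι → N →ₗ[K] N} (hp : IsGradedProjection 𝓜 p)
    (hq : IsGradedProjection 𝓝 q) (φ : M →+ N) (hφ : ∀ τ, ∀ m ∈ 𝓜 τ, φ m ∈ 𝓝 τ) (τ : ι) (m : M) :
    φ (p τ m) = q τ (φ m) := by
  have hm : m ∈ ⨆ τ, 𝓜 τ := hp.iSup_eq_top ▸ Submodule.mem_top
  induction hm using Submodule.iSup_induction' with
  | mem τ' m hm =>
    by_cases h : τ' = τ
    · subst h
      rw [hp.self _ _ hm, hq.self _ _ (hφ _ _ hm)]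
    · rw [hp.ne _ _ h _ hm, hq.ne _ _ h _ (hφ _ _ hm), map_zero]
  | zero => simp
  | add x y _ _ hx hy => simp only [map_add, hx, hy]

/-- Projecting any preimage gives a homogeneous one; thus surjectivity and exactness pass to graded
pieces. -/
theorem IsGradedProjection.exists_mem_eq {K ι M N : Type*} [Field K] [AddCommGroup M] [Module K M]
    [AddCommGroup N] [Module K N] {𝓜 : ι → Submodule K M} {p : ι → M →ₗ[K] M}
    {𝓝 : ι → Submodule K N} {q : ι → N →ₗ[K] N} (hp : IsGradedProjection 𝓜 p)
    (hq : IsGradedProjection 𝓝 q) (φ : M →+ N) (hφ : ∀ τ, ∀ m ∈ 𝓜 τ, φ m ∈ 𝓝 τ) {τ : ι} {n : N}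
    (hn : n ∈ 𝓝 τ) (hnφ : ∃ m, φ m = n) : ∃ m ∈ 𝓜 τ, φ m = n := by
  obtain ⟨m, rfl⟩ := hnφ
  exact ⟨p τ m, hp.mem τ m, by rw [hp.map_comm hq φ hφ, hq.self _ _ hn]⟩

section shiftedFree

variable {K : Type*} [Field K] {V : Type*}

open Classical in
/-- The projection of `⨁_σ S(-σ)^{β σ}` onto its piece of degree `τ`. -/
noncomputable def shiftedFreeProj (β : (V →₀ ℕ) → ℕ) (τ : V →₀ ℕ) :
    ShiftedFree K β →ₗ[K] ShiftedFree K β where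
  toFun f := Finsupp.onFinset f.support
    (fun j => if j.1 ≤ τ then monomial (τ - j.1) (coeff (τ - j.1) (f j)) else 0) fun j hj => by
      rw [Finsupp.mem_support_iff]
      intro h
      simp [h] at hj
  map_add' f g := by
    ext1 j
    simp only [Finsupp.onFinset_apply, Finsupp.add_apply]
    split_ifs <;> simp
  map_smul' c f := by
    ext1 j
    simp only [Finsupp.onFinset_apply, Finsupp.smul_apply, RingHom.id_apply]
    split_ifs <;> simp [smul_monomial]

theorem shiftedFreeProj_apply_of_le {β : (V →₀ ℕ) → ℕ} {τ : V →₀ ℕ} (f : ShiftedFree K β)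
    {j : Σ σ : V →₀ ℕ, Fin (β σ)} (h : j.1 ≤ τ) :
    shiftedFreeProj β τ f j = monomial (τ - j.1) (coeff (τ - j.1) (f j)) :=
  if_pos h

theorem shiftedFreeProj_apply_of_not_le {β : (V →₀ ℕ) → ℕ} {τ : V →₀ ℕ} (f : ShiftedFree K β)
    {j : Σ σ : V →₀ ℕ, Fin (β σ)} (h : ¬ j.1 ≤ τ) : shiftedFreeProj β τ f j = 0 :=
  if_neg h

theorem coeff_shiftedFreeProj_of_eq {β : (V →₀ ℕ) → ℕ} {τ : V →₀ ℕ} (f : ShiftedFree K β)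
    {j : Σ σ : V →₀ ℕ, Fin (β σ)} {m : V →₀ ℕ} (h : m + j.1 = τ) :
    coeff m (shiftedFreeProj β τ f j) = coeff m (f j) := by
  classical
  subst h
  rw [shiftedFreeProj_apply_of_le f le_add_self, add_tsub_cancel_right, coeff_monomial, if_pos rfl]

theorem coeff_shiftedFreeProj_of_ne {β : (V →₀ ℕ) → ℕ} {τ : V →₀ ℕ} (f : ShiftedFree K β)
    {j : Σ σ : V →₀ ℕ, Fin (β σ)} {m : V →₀ ℕ} (h : m + j.1 ≠ τ) :
    coeff m (shiftedFreeProj β τ f j) = 0 := by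
  classical
  by_cases hj : j.1 ≤ τ
  · rw [shiftedFreeProj_apply_of_le f hj, coeff_monomial, if_neg]
    rintro rfl
    exact h (tsub_add_cancel_of_le hj)
  · rw [shiftedFreeProj_apply_of_not_le f hj, coeff_zero]

theorem single_monomial_mem_shiftedFreePiece {β : (V →₀ ℕ) → ℕ} (j : Σ σ : V →₀ ℕ, Fin (β σ))
    (m : V →₀ ℕ) (c : K) :
    (Finsupp.single j (monomial m c) : ShiftedFree K β) ∈ shiftedFreePiece K β (m + j.1) := by
  classical
  intro k m' hm'
  rw [Finsupp.single_apply]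
  split_ifs with h
  · subst h
    rw [coeff_monomial, if_neg]
    rintro rfl
    exact hm' rfl
  · rw [coeff_zero]

theorem isGradedProjection_shiftedFreeProj (β : (V →₀ ℕ) → ℕ) :
    IsGradedProjection (shiftedFreePiece K β) (shiftedFreeProj β) where
  mem τ f j m hm := coeff_shiftedFreeProj_of_ne f hm
  self τ f hf := by
    ext j m
    by_cases h : m + j.1 = τ
    · exact coeff_shiftedFreeProj_of_eq f h
    · rw [coeff_shiftedFreeProj_of_ne f h, hf j m h]
  ne τ τ' hτ f hf := by
    ext j m
    rw [Finsupp.zero_apply, coeff_zero]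
    by_cases h : m + j.1 = τ
    · rw [coeff_shiftedFreeProj_of_eq f h]
      exact hf j m fun h' => hτ (h' ▸ h)
    · exact coeff_shiftedFreeProj_of_ne f h
  iSup_eq_top := by
    rw [eq_top_iff]
    rintro f -
    induction f using Finsupp.induction_linear with
    | zero => exact zero_mem _
    | add f g hf hg => exact add_mem hf hg
    | single j p =>
      induction p using MvPolynomial.induction_on' with
      | monomial m c =>
        exact Submodule.mem_iSup_of_mem (m + j.1) (single_monomial_mem_shiftedFreePiece j m c)
      | add p q hp hq =>
        rw [Finsupp.single_add]
        exact add_mem hp hq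

end shiftedFree

/-! ### The edge ideal and the grading of its quotient -/

section edgeIdeal

variable {K : Type*} [Field K] {V : Type*}

theorem mem_edgeIdeal_iff (G : SimpleGraph V) (f : MvPolynomial V K) :
    f ∈ edgeIdeal K G ↔ ∀ m ∈ f.support, ∃ u v, G.Adj u v ∧
      Finsupp.single u 1 + Finsupp.single v 1 ≤ m := by
  have : edgeIdeal K G = Ideal.span ((fun s => monomial s (1 : K)) ''
      {s | ∃ u v, G.Adj u v ∧ s = Finsupp.single u 1 + Finsupp.single v 1}) := by
    unfold edgeIdeal
    congr 1
    ext f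
    constructor
    · rintro ⟨u, v, huv, rfl⟩
      refine ⟨_, ⟨u, v, huv, rfl⟩, ?_⟩
      simp [X, monomial_mul]
    · rintro ⟨_, ⟨u, v, huv, rfl⟩, rfl⟩
      refine ⟨u, v, huv, ?_⟩
      simp [X, monomial_mul]
  rw [this, mem_ideal_span_monomial_image]
  refine forall₂_congr fun m _ => ?_
  constructor
  · rintro ⟨_, ⟨u, v, huv, rfl⟩, h⟩
    exact ⟨u, v, huv, h⟩
  · rintro ⟨u, v, huv, h⟩
    exact ⟨_, ⟨u, v, huv, rfl⟩, h⟩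

theorem monomial_coeff_mem_edgeIdeal (G : SimpleGraph V) {f : MvPolynomial V K}
    (hf : f ∈ edgeIdeal K G) (τ : V →₀ ℕ) : monomial τ (coeff τ f) ∈ edgeIdeal K G := by
  classical
  rw [mem_edgeIdeal_iff] at hf ⊢
  intro m hm
  rw [mem_support_iff, coeff_monomial] at hm
  split_ifs at hm with h
  · subst h
    exact hf _ (mem_support_iff.2 hm)
  · exact absurd rfl hm

theorem monomial_zeroOneVector_mem_edgeIdeal_iff (G : SimpleGraph V) (B : Finset V) (c : K) :
    monomial (zeroOneVector B) c ∈ edgeIdeal K G ↔ c = 0 ∨ ¬ G.IsIndepSet (B : Set V) := by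
  classical
  rw [mem_edgeIdeal_iff]
  by_cases hc : c = 0
  · simp [hc]
  · rw [support_monomial, if_neg hc]
    simp only [Finset.mem_singleton, forall_eq, hc, false_or]
    constructor
    · rintro ⟨u, v, huv, h⟩ hB
      have hu := h u
      have hv := h v
      simp only [Finsupp.add_apply, Finsupp.single_eq_same, zeroOneVector_apply] at hu hv
      refine hB (x := u) (y := v) ?_ ?_ huv.ne huv
      · by_contra hmem
        rw [Finset.mem_coe] at hmem
        rw [if_neg hmem] at hu
        omega
      · by_contra hmem
        rw [Finset.mem_coe] at hmem
        rw [if_neg hmem] at hv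
        omega
    · intro h
      simp only [SimpleGraph.IsIndepSet, Set.Pairwise, not_forall, not_not] at h
      obtain ⟨u, hu, v, hv, hne, huv⟩ := h
      refine ⟨u, v, huv, fun w => ?_⟩
      rw [Finset.mem_coe] at hu hv
      simp only [Finsupp.add_apply, Finsupp.single_apply, zeroOneVector_apply]
      by_cases h1 : u = w
      · subst h1
        simp [hu, hne.symm]
      · by_cases h2 : v = w
        · subst h2
          simp [hv, h1]
        · simp [h1, h2]

/-- The projection of `S / I(G)` onto its piece of degree `τ`. -/
noncomputable def edgeIdealProj (G : SimpleGraph V) (τ : V →₀ ℕ) :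
    (MvPolynomial V K ⧸ edgeIdeal K G) →ₗ[K] (MvPolynomial V K ⧸ edgeIdeal K G) :=
  ((Submodule.Quotient.restrictScalarsEquiv K (edgeIdeal K G)).toLinearMap ∘ₗ
    Submodule.mapQ ((edgeIdeal K G).restrictScalars K) ((edgeIdeal K G).restrictScalars K)
      (monomial τ ∘ₗ lcoeff K τ) fun _ hf => monomial_coeff_mem_edgeIdeal G hf τ) ∘ₗ
    (Submodule.Quotient.restrictScalarsEquiv K (edgeIdeal K G)).symm.toLinearMap

theorem edgeIdealProj_mk (G : SimpleGraph V) (τ : V →₀ ℕ) (f : MvPolynomial V K) :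
    edgeIdealProj G τ (Ideal.Quotient.mk (edgeIdeal K G) f) =
      Ideal.Quotient.mk (edgeIdeal K G) (monomial τ (coeff τ f)) :=
  rfl

theorem mem_quotientPiece_iff {I : Ideal (MvPolynomial V K)} {τ : V →₀ ℕ}
    {m : MvPolynomial V K ⧸ I} :
    m ∈ quotientPiece K I τ ↔ ∃ c : K, Ideal.Quotient.mk I (monomial τ c) = m := by
  simp [quotientPiece]

theorem isGradedProjection_edgeIdealProj (G : SimpleGraph V) :
    IsGradedProjection (quotientPiece K (edgeIdeal K G)) (edgeIdealProj G) where
  mem τ m := by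
    obtain ⟨f, rfl⟩ := Ideal.Quotient.mk_surjective m
    rw [edgeIdealProj_mk]
    exact mem_quotientPiece_iff.2 ⟨_, rfl⟩
  self τ m hm := by
    classical
    obtain ⟨c, rfl⟩ := mem_quotientPiece_iff.1 hm
    rw [edgeIdealProj_mk, coeff_monomial, if_pos rfl]
  ne τ τ' hτ m hm := by
    classical
    obtain ⟨c, rfl⟩ := mem_quotientPiece_iff.1 hm
    rw [edgeIdealProj_mk, coeff_monomial, if_neg hτ, map_zero, map_zero]
  iSup_eq_top := by
    rw [eq_top_iff]
    rintro m -
    obtain ⟨f, rfl⟩ := Ideal.Quotient.mk_surjective m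
    induction f using MvPolynomial.induction_on' with
    | monomial m c => exact Submodule.mem_iSup_of_mem m (mem_quotientPiece_iff.2 ⟨c, rfl⟩)
    | add p q hp hq =>
      rw [map_add]
      exact add_mem hp hq

end edgeIdeal

/-! ### Betti numbers as Koszul cohomology -/

/-- Below the top degree the free module is acyclic. Degree n + 1 may be the top one, but there a
cocycle with values in the kernel has no constant coefficients by minimality, hence still bounds in
the free module. -/
theorem hasKoszulCohomology_iff_succ {K : Type*} [Field K] {V : Type*} [Finite V]
    [LinearOrder V] {M : Type*} [AddCommGroup M] [Module (MvPolynomial V K) M]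
    (σ : Finset V) {n : ℤ} (hn : n < σ.card) {β : (V →₀ ℕ) → ℕ}
    (φ : ShiftedFree K β →ₗ[MvPolynomial V K] M)
    {𝓜 : Finset V → AddSubgroup M} (hφ : ∀ B, ∀ e ∈ squarefreePiece K β B, φ e ∈ 𝓜 B)
    (hsurj : ∀ B, ∀ m ∈ 𝓜 B, ∃ e ∈ squarefreePiece K β B, φ e = m)
    (hmin : ∀ f, φ f = 0 → ∀ j, constantCoeff (f j) = 0) :
    HasKoszulCohomology (X : V → MvPolynomial V K) σ n 𝓜 ↔
      HasKoszulCohomology (X : V → MvPolynomial V K) σ (n + 1)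
        (fun B => squarefreePiece K β B ⊓ φ.toAddMonoidHom.ker) := by
  refine hasKoszulCohomology_iff_ker X σ n φ (X_smul_mem_squarefreePiece β) hφ hsurj
    (fun z hz => isKoszulCoboundary_squarefreePiece hz fun h => absurd h hn.ne)
    (fun z hz => isKoszulCoboundary_squarefreePiece ⟨fun B hB h => (hz.1 B hB h).1, hz.2⟩
      fun h j _ => hmin _ (hz.1 σ subset_rfl h.symm).2 j)

namespace MinimalGradedFreeResolution

variable {K : Type*} [Field K] {V : Type*} {G : SimpleGraph V}
  (F : MinimalGradedFreeResolution K (quotientPiece K (edgeIdeal K G)))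

/-- The squarefree pieces of the `i`-th syzygy module, as a submodule of `F_i`. -/
noncomputable def syzygyPiece : ∀ (i : ℕ) (_ : Finset V), AddSubgroup (ShiftedFree K (F.betti i))
  | 0, B => squarefreePiece K (F.betti 0) B ⊓ F.ε.toAddMonoidHom.ker
  | i + 1, B => squarefreePiece K (F.betti (i + 1)) B ⊓ (F.d i).toAddMonoidHom.ker

theorem d_mem_syzygyPiece (i : ℕ) (B : Finset V) (e : ShiftedFree K (F.betti (i + 1)))
    (he : e ∈ squarefreePiece K (F.betti (i + 1)) B) : F.d i e ∈ F.syzygyPiece i B := by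
  have h := F.d_graded i _ e he
  cases i with
  | zero => exact ⟨h, F.exact_zero.apply_apply_eq_zero e⟩
  | succ i => exact ⟨h, (F.exact_succ i).apply_apply_eq_zero e⟩

theorem exists_d_eq_of_mem_syzygyPiece (i : ℕ) (B : Finset V) (m : ShiftedFree K (F.betti i))
    (hm : m ∈ F.syzygyPiece i B) :
    ∃ e ∈ squarefreePiece K (F.betti (i + 1)) B, F.d i e = m := by
  have hmem : m ∈ squarefreePiece K (F.betti i) B := by
    cases i with
    | zero => exact hm.1
    | succ i => exact hm.1
  refine (isGradedProjection_shiftedFreeProj _).exists_mem_eq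
    (isGradedProjection_shiftedFreeProj _) (F.d i).toAddMonoidHom (F.d_graded i) hmem ?_
  cases i with
  | zero => exact (F.exact_zero m).1 hm.2
  | succ i => exact (F.exact_succ i m).1 hm.2

theorem constantCoeff_eq_zero_of_ε_eq_zero (f : ShiftedFree K (F.betti 0)) (hf : F.ε f = 0)
    (j : Σ σ : V →₀ ℕ, Fin (F.betti 0 σ)) : constantCoeff (f j) = 0 := by
  obtain ⟨e, rfl⟩ := (F.exact_zero f).1 hf
  exact F.minimal 0 e j

theorem constantCoeff_eq_zero_of_d_eq_zero (i : ℕ) (f : ShiftedFree K (F.betti (i + 1)))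
    (hf : F.d i f = 0) (j : Σ σ : V →₀ ℕ, Fin (F.betti (i + 1) σ)) : constantCoeff (f j) = 0 := by
  obtain ⟨e, rfl⟩ := (F.exact_succ i f).1 hf
  exact F.minimal (i + 1) e j

/-- One shift along ε and i shifts along the differentials raise the degree from |σ| - (i + 1) to
|σ|, ending at the syzygy module inside F_i, whose minimal generators correspond to the basis of
F_{i+1}. -/
theorem betti_ne_zero_iff [Finite V] [LinearOrder V] (i : ℕ) (σ : Finset V) :
    F.betti (i + 1) (zeroOneVector σ) ≠ 0 ↔
      HasKoszulCohomology (X : V → MvPolynomial V K) σ ((σ.card : ℤ) - (i + 1 : ℕ))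
        (fun B => (quotientPiece K (edgeIdeal K G) (zeroOneVector B)).toAddSubgroup) := by
  have key : ∀ k : ℕ, k ≤ i → (HasKoszulCohomology (X : V → MvPolynomial V K) σ
      ((σ.card : ℤ) - (i + 1 : ℕ)) (fun B =>
        (quotientPiece K (edgeIdeal K G) (zeroOneVector B)).toAddSubgroup) ↔
      HasKoszulCohomology (X : V → MvPolynomial V K) σ ((σ.card : ℤ) - (i : ℤ) + k)
        (F.syzygyPiece k)) := by
    intro k
    induction k with
    | zero =>
      intro _
      have h : (σ.card : ℤ) - (i : ℤ) + (0 : ℕ) = σ.card - (i + 1 : ℕ) + 1 := by push_cast; ring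
      rw [h]
      refine hasKoszulCohomology_iff_succ σ (by push_cast; omega) F.ε
        (fun B e he => F.ε_graded (zeroOneVector B) e he) (fun B m hm => ?_)
        F.constantCoeff_eq_zero_of_ε_eq_zero
      exact (isGradedProjection_shiftedFreeProj _).exists_mem_eq
        (isGradedProjection_edgeIdealProj G) F.ε.toAddMonoidHom F.ε_graded hm (F.ε_surjective m)
    | succ k ih =>
      intro hk
      have h : (σ.card : ℤ) - (i : ℤ) + (k + 1 : ℕ) = σ.card - i + k + 1 := by push_cast; ring
      rw [ih (Nat.le_of_succ_le hk), h]
      exact hasKoszulCohomology_iff_succ σ (by omega) (F.d k) (F.d_mem_syzygyPiece k)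
        (F.exists_d_eq_of_mem_syzygyPiece k) (F.constantCoeff_eq_zero_of_d_eq_zero k)
  rw [key i le_rfl, ← hasKoszulCohomology_card_iff σ (F.d i) (F.d_mem_syzygyPiece i)
    (F.exists_d_eq_of_mem_syzygyPiece i) (F.constantCoeff_eq_zero_of_d_eq_zero i)]
  simp

end MinimalGradedFreeResolution

/-! ### Hochster's formula for the independence complex -/

theorem map_koszulSign {R S : Type*} [CommRing R] [CommRing S] (f : R →+* S) {V : Type*}
    [LinearOrder V] (v : V) (B : Finset V) : f (koszulSign R v B) = koszulSign S v B := by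
  simp [koszulSign]

/-- As x_v · x^{B∖v} = x^B, the variables drop out and the simplicial coboundary over K, which is
`koszulDiff 1`, remains. -/
theorem koszulDiff_mk_monomial {K : Type*} [Field K] {V : Type*} [LinearOrder V]
    (I : Ideal (MvPolynomial V K)) (c : Finset V → K) (B : Finset V) :
    koszulDiff (X : V → MvPolynomial V K)
        (fun A => Ideal.Quotient.mk I (monomial (zeroOneVector A) (c A))) B =
      Ideal.Quotient.mk I (monomial (zeroOneVector B) (koszulDiff (1 : V → K) c B)) := by
  unfold koszulDiff
  rw [map_sum, map_sum]
  refine Finset.sum_congr rfl fun v hv => ?_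
  rw [Pi.one_apply, mul_one, smul_eq_mul, ← map_koszulSign C, ← zeroOneVector_erase hv]
  change Ideal.Quotient.mk I (C (koszulSign K v B) * X v *
    monomial (zeroOneVector (B.erase v)) (c (B.erase v))) = _
  rw [X, C_mul_monomial, monomial_mul, mul_one]

/-- The cohomology of the strand `σ` of the Koszul complex of `S / I(G)` is the simplicial
cohomology of the independence complex of `G` restricted to `σ`. -/
theorem hasKoszulCohomology_edgeIdeal_iff {K : Type*} [Field K] {V : Type*} [LinearOrder V]
    (G : SimpleGraph V) (σ : Finset V) (n : ℤ) :
    HasKoszulCohomology (X : V → MvPolynomial V K) σ n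
        (fun B => (quotientPiece K (edgeIdeal K G) (zeroOneVector B)).toAddSubgroup) ↔
      ∃ c : Finset V → K, (∀ B ⊆ σ, G.IsIndepSet (B : Set V) → (B.card : ℤ) = n + 1 →
          koszulDiff (1 : V → K) c B = 0) ∧
        ¬ ∃ b : Finset V → K, ∀ B ⊆ σ, G.IsIndepSet (B : Set V) → (B.card : ℤ) = n →
          koszulDiff (1 : V → K) b B = c B := by
  have hlift : ∀ (k : ℤ) (z : Finset V → MvPolynomial V K ⧸ edgeIdeal K G),
      (∀ B ⊆ σ, (B.card : ℤ) = k → z B ∈ quotientPiece K (edgeIdeal K G) (zeroOneVector B)) →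
      ∃ c : Finset V → K, ∀ B ⊆ σ, (B.card : ℤ) = k →
        Ideal.Quotient.mk (edgeIdeal K G) (monomial (zeroOneVector B) (c B)) = z B := by
    intro k z hz
    have : ∀ B, ∃ c : K, B ⊆ σ → (B.card : ℤ) = k →
        Ideal.Quotient.mk (edgeIdeal K G) (monomial (zeroOneVector B) c) = z B := by
      intro B
      by_cases h : B ⊆ σ ∧ (B.card : ℤ) = k
      · obtain ⟨c, hc⟩ := mem_quotientPiece_iff.1 (hz B h.1 h.2)
        exact ⟨c, fun _ _ => hc⟩
      · exact ⟨0, fun a b => absurd ⟨a, b⟩ h⟩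
    choose c hc using this
    exact ⟨c, hc⟩
  have hdiff : ∀ (k : ℤ) (z : Finset V → MvPolynomial V K ⧸ edgeIdeal K G) (c : Finset V → K),
      (∀ B ⊆ σ, (B.card : ℤ) = k →
        Ideal.Quotient.mk (edgeIdeal K G) (monomial (zeroOneVector B) (c B)) = z B) →
      ∀ B ⊆ σ, (B.card : ℤ) = k + 1 → koszulDiff (X : V → MvPolynomial V K) z B =
        Ideal.Quotient.mk (edgeIdeal K G)
          (monomial (zeroOneVector B) (koszulDiff (1 : V → K) c B)) := by
    intro k z c hc B hB hk
    rw [← koszulDiff_mk_monomial]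
    refine koszulDiff_congr _ fun v hv => (hc _ ((Finset.erase_subset _ _).trans hB) ?_).symm
    have := card_erase_cast hv
    omega
  constructor
  · rintro ⟨z, ⟨hz, hz'⟩, hnb⟩
    obtain ⟨c, hc⟩ := hlift n z hz
    refine ⟨c, fun B hB hi hn => ?_, ?_⟩
    · have h := hz' B hB hn
      rw [hdiff n z c hc B hB hn, Ideal.Quotient.eq_zero_iff_mem,
        monomial_zeroOneVector_mem_edgeIdeal_iff] at h
      exact h.resolve_right fun h => h hi
    · rintro ⟨b, hb⟩
      refine hnb ⟨fun B => Ideal.Quotient.mk _ (monomial (zeroOneVector B) (b B)),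
        fun B _ _ => mem_quotientPiece_iff.2 ⟨_, rfl⟩, fun B hB hn => ?_⟩
      rw [koszulDiff_mk_monomial, ← hc B hB hn]
      by_cases hi : G.IsIndepSet (B : Set V)
      · rw [hb B hB hi hn]
      · have h0 : ∀ a : K,
            Ideal.Quotient.mk (edgeIdeal K G) (monomial (zeroOneVector B) a) = 0 := fun a =>
          Ideal.Quotient.eq_zero_iff_mem.2
            ((monomial_zeroOneVector_mem_edgeIdeal_iff G B a).2 (Or.inr hi))
        rw [h0, h0]
  · rintro ⟨c, hc, hnb⟩
    refine ⟨fun B => Ideal.Quotient.mk _ (monomial (zeroOneVector B) (c B)),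
      ⟨fun B _ _ => mem_quotientPiece_iff.2 ⟨_, rfl⟩, fun B hB hn => ?_⟩, ?_⟩
    · rw [koszulDiff_mk_monomial, Ideal.Quotient.eq_zero_iff_mem,
        monomial_zeroOneVector_mem_edgeIdeal_iff]
      by_cases hi : G.IsIndepSet (B : Set V)
      · exact Or.inl (hc B hB hi hn)
      · exact Or.inr hi
    · rintro ⟨w, hw, hwc⟩
      obtain ⟨b, hb⟩ := hlift (n - 1) w (fun B hB hn => hw B hB (by omega))
      refine hnb ⟨b, fun B hB hi hn => ?_⟩
      have h : Ideal.Quotient.mk (edgeIdeal K G)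
          (monomial (zeroOneVector B) (koszulDiff (1 : V → K) b B - c B)) = 0 := by
        rw [map_sub, map_sub, ← hdiff (n - 1) w b hb B hB (by omega), hwc B hB hn, sub_self]
      rw [Ideal.Quotient.eq_zero_iff_mem, monomial_zeroOneVector_mem_edgeIdeal_iff] at h
      exact sub_eq_zero.1 (h.resolve_right fun h => h hi)

/-! ### Cohomology of the independence complex -/

/-- Vanishing of the cohomology of the independence complex in positive degrees, given an
elimination ordering. -/
theorem exists_koszulDiff_eq_of_simplicial {K : Type*} [Field K] {V : Type*} [LinearOrder V]
    (G : SimpleGraph V)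
    (hG : ∀ τ : Finset V, τ.Nonempty → ∃ v ∈ τ, ∀ u ∈ τ, ∀ w ∈ τ, u ≠ v → w ≠ v → u ≠ w →
      ¬ G.Adj v u → ¬ G.Adj v w → ¬ G.Adj u w)
    {n : ℕ} (hn : 2 ≤ n) (σ : Finset V) (c : Finset V → K)
    (hc : ∀ B ⊆ σ, G.IsIndepSet (B : Set V) → B.card = n + 1 → koszulDiff (1 : V → K) c B = 0) :
    ∃ b : Finset V → K, ∀ B ⊆ σ, G.IsIndepSet (B : Set V) → B.card = n →
      koszulDiff (1 : V → K) b B = c B := by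
  induction hs : σ.card generalizing σ c with
  | zero =>
    refine ⟨0, fun B hB _ hBn => ?_⟩
    have := Finset.card_le_card hB
    omega
  | succ s ih =>
    obtain ⟨v, hvσ, hv⟩ := hG σ (Finset.card_pos.1 (by omega))
    obtain ⟨b₀, hb₀⟩ := ih (σ.erase v)
      c (fun B hB => hc B (hB.trans (Finset.erase_subset _ _)))
      (by rw [Finset.card_erase_of_mem hvσ, hs]; rfl)
    -- Extending the primitive on σ∖v by zero and subtracting its coboundary leaves a cocycle c'
    -- that vanishes on the faces avoiding v.
    set b₁ : Finset V → K := fun B => if v ∈ B then 0 else b₀ B with hb₁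
    set c' : Finset V → K := fun B => c B - koszulDiff (1 : V → K) b₁ B with hc'
    have hc'0 : ∀ B ⊆ σ, v ∉ B → G.IsIndepSet (B : Set V) → B.card = n → c' B = 0 := by
      intro B hB hvB hi hBn
      have : koszulDiff (1 : V → K) b₁ B = koszulDiff (1 : V → K) b₀ B :=
        koszulDiff_congr _ fun u _ => if_neg fun h => hvB (Finset.mem_of_mem_erase h)
      rw [hc']
      simp only
      rw [this, hb₀ B (Finset.subset_erase.2 ⟨hB, hvB⟩) hi hBn, sub_self]
    have hc'd : ∀ B ⊆ σ, G.IsIndepSet (B : Set V) → B.card = n + 1 →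
        koszulDiff (1 : V → K) c' B = 0 := by
      intro B hB hi hBn
      rw [hc', koszulDiff_sub, hc B hB hi hBn]
      have := koszulDiff_koszulDiff (1 : V → K) b₁ B
      rw [this, sub_zero]
    suffices h : ∃ b : Finset V → K, ∀ B ⊆ σ, G.IsIndepSet (B : Set V) → B.card = n →
        koszulDiff (1 : V → K) b B = c' B by
      obtain ⟨b, hb⟩ := h
      refine ⟨fun B => b B + b₁ B, fun B hB hi hBn => ?_⟩
      rw [koszulDiff_add, hb B hB hi hBn, hc']
      exact sub_add_cancel _ _
    by_cases hw : ∃ w ∈ σ, w ≠ v ∧ ¬ G.Adj v w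
    · obtain ⟨w, hwσ, hwv, hvw⟩ := hw
      -- The non-neighbours of v are pairwise non-adjacent, so a face containing v remains a face
      -- when w is added. Contraction against w, restricted to faces through v, is a primitive of
      -- c'.
      set h : Finset V → K := fun B =>
        if w ∉ B ∧ v ∈ B then koszulSign K w (insert w B) * c' (insert w B) else 0 with hh
      refine ⟨h, fun B hB hi hBn => ?_⟩
      by_cases hvB : v ∈ B
      · have hins : G.IsIndepSet ((insert w B : Finset V) : Set V) := by
          intro x hx y hy hxy
          rw [Finset.mem_coe, Finset.mem_insert] at hx hy
          have hB' : ∀ y ∈ B, w ≠ y → ¬ G.Adj w y := by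
            intro y hy hwy
            by_cases hyv : y = v
            · rw [hyv]
              exact fun h => hvw h.symm
            · exact hv w hwσ y (hB hy) hwv hyv hwy hvw (hi hvB hy (Ne.symm hyv))
          rcases hx with rfl | hx <;> rcases hy with rfl | hy
          · exact absurd rfl hxy
          · exact hB' y hy hxy
          · exact fun h => hB' x hx hxy.symm h.symm
          · exact hi hx hy hxy
        by_cases hwB : w ∈ B
        · refine koszulDiff_contraction_of_mem 1 hwB (fun u _ huw => ?_) ?_
          · exact if_neg fun h => h.1 (Finset.mem_erase.2 ⟨huw.symm, hwB⟩)
          · have : h (B.erase w) = koszulSign K w (insert w (B.erase w)) *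
                c' (insert w (B.erase w)) :=
              if_pos ⟨Finset.notMem_erase w B, Finset.mem_erase.2 ⟨hwv.symm, hvB⟩⟩
            rw [this, Finset.insert_erase hwB, Pi.one_apply, one_smul, smul_eq_mul]
        · have := koszulDiff_contraction_of_notMem (1 : V → K) (z := c') (h := h) hwB
            (hc'd _ (Finset.insert_subset hwσ hB) hins
              (by rw [Finset.card_insert_of_notMem hwB, hBn])) ?_
          · simpa using this
          · intro u hu
            rw [Pi.one_apply, one_smul, smul_eq_mul]
            have hwu : w ∉ B.erase u := fun h => hwB (Finset.mem_of_mem_erase h)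
            -- Removing v leaves the range where h is supported, but there c' vanishes as well.
            by_cases huv : u = v
            · subst huv
              have : h (B.erase u) = 0 := if_neg fun h => Finset.notMem_erase u B h.2
              rw [this, hc'0, mul_zero]
              · exact Finset.insert_subset hwσ ((Finset.erase_subset _ _).trans hB)
              · simp [hwv.symm]
              · refine hins.mono ?_
                exact_mod_cast Finset.insert_subset_insert w (Finset.erase_subset u B)
              · rw [Finset.card_insert_of_notMem hwu, Finset.card_erase_add_one hu, hBn]
            · exact if_pos ⟨hwu, Finset.mem_erase.2 ⟨Ne.symm huv, hvB⟩⟩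
      · rw [hc'0 B hB hvB hi hBn]
        refine Finset.sum_eq_zero fun u _ => ?_
        have : h (B.erase u) = 0 := if_neg fun h => hvB (Finset.mem_of_mem_erase h.2)
        rw [this, smul_zero]
    -- Here v is an isolated point of the complex, so no face of size n ≥ 2 contains it.
    · push Not at hw
      refine ⟨0, fun B hB hi hBn => ?_⟩
      have hvB : v ∉ B := by
        intro hvB
        obtain ⟨w, hwB, hwv⟩ := Finset.exists_mem_ne (by omega : 1 < B.card) v
        exact hi hvB hwB hwv.symm (hw w (hB hwB) hwv)
      rw [hc'0 B hB hvB hi hBn]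
      simp [koszulDiff]

theorem koszulDiff_one_pair {K : Type*} [Field K] {V : Type*} [LinearOrder V] (c : Finset V → K)
    {u w : V} (h : u < w) : koszulDiff (1 : V → K) c {u, w} = c {w} - c {u} := by
  unfold koszulDiff
  rw [Finset.sum_pair h.ne]
  have h1 : ({u, w} : Finset V).erase u = {w} := by
    ext x; simp only [Finset.mem_erase, Finset.mem_insert, Finset.mem_singleton]; grind
  have h2 : ({u, w} : Finset V).erase w = {u} := by
    ext x; simp only [Finset.mem_erase, Finset.mem_insert, Finset.mem_singleton]; grind
  have h3 : ({u, w} : Finset V).filter (· < u) = ∅ := by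
    ext x; simp only [Finset.mem_filter, Finset.mem_insert, Finset.mem_singleton]; grind
  have h4 : ({u, w} : Finset V).filter (· < w) = {u} := by
    ext x; simp only [Finset.mem_filter, Finset.mem_insert, Finset.mem_singleton]; grind
  simp [koszulSign, h1, h2, h3, h4, sub_eq_add_neg]

theorem koszulDiff_one_singleton {K : Type*} [Field K] {V : Type*} [LinearOrder V]
    (c : Finset V → K) (u : V) : koszulDiff (1 : V → K) c {u} = c ∅ := by
  simp [koszulDiff, koszulSign, Finset.filter_singleton]

/-- `H̃⁰` of the independence complex: the locally constant functions modulo constants. -/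
theorem hasCompleteBipartiteSpanningSubgraph_iff {K : Type*} [Field K] {V : Type*}
    [LinearOrder V] (G : SimpleGraph V) (σ : Finset V) :
    (∃ c : Finset V → K, (∀ B ⊆ σ, G.IsIndepSet (B : Set V) → (B.card : ℤ) = 1 + 1 →
          koszulDiff (1 : V → K) c B = 0) ∧
        ¬ ∃ b : Finset V → K, ∀ B ⊆ σ, G.IsIndepSet (B : Set V) → (B.card : ℤ) = 1 →
          koszulDiff (1 : V → K) b B = c B) ↔
      (G.induce (σ : Set V)).HasCompleteBipartiteSpanningSubgraph := by
  have hind : ∀ u w, G.IsIndepSet (({u, w} : Finset V) : Set V) ↔ ¬ G.Adj u w := by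
    intro u w
    constructor
    · intro h huw
      exact h (x := u) (y := w) (by simp) (by simp) huw.ne huw
    · intro h x hx y hy hxy
      simp only [Finset.coe_insert, Finset.coe_singleton, Set.mem_insert_iff,
        Set.mem_singleton_iff] at hx hy
      rcases hx with rfl | rfl <;> rcases hy with rfl | rfl
      · exact absurd rfl hxy
      · exact h
      · exact fun h' => h h'.symm
      · exact absurd rfl hxy
  have hcocycle : ∀ c : Finset V → K, (∀ B ⊆ σ, G.IsIndepSet (B : Set V) → (B.card : ℤ) = 1 + 1 →
      koszulDiff (1 : V → K) c B = 0) ↔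
        ∀ u ∈ σ, ∀ w ∈ σ, u ≠ w → ¬ G.Adj u w → c {u} = c {w} := by
    intro c
    constructor
    · intro h
      have key : ∀ u ∈ σ, ∀ w ∈ σ, u < w → ¬ G.Adj u w → c {u} = c {w} := by
        intro u hu w hw huw hadj
        have := h {u, w} (by simp [Finset.insert_subset_iff, hu, hw]) ((hind u w).2 hadj)
          (by rw [Finset.card_pair huw.ne]; rfl)
        rw [koszulDiff_one_pair c huw] at this
        exact (sub_eq_zero.1 this).symm
      intro u hu w hw huw hadj
      rcases lt_or_gt_of_ne huw with h1 | h1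
      · exact key u hu w hw h1 hadj
      · exact (key w hw u hu h1 fun h => hadj h.symm).symm
    · intro h B hB hi hcard
      obtain ⟨u, w, huw, rfl⟩ := Finset.card_eq_two.1 (by exact_mod_cast hcard)
      have hu : u ∈ σ := hB (by simp)
      have hw : w ∈ σ := hB (by simp)
      have heq := h u hu w hw huw ((hind u w).1 hi)
      rcases lt_or_gt_of_ne huw with h1 | h1
      · rw [koszulDiff_one_pair c h1, heq, sub_self]
      · rw [Finset.pair_comm, koszulDiff_one_pair c h1, heq, sub_self]
  have hcobdry : ∀ c : Finset V → K, (∃ b : Finset V → K, ∀ B ⊆ σ, G.IsIndepSet (B : Set V) →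
      (B.card : ℤ) = 1 → koszulDiff (1 : V → K) b B = c B) ↔ ∃ a : K, ∀ u ∈ σ, c {u} = a := by
    intro c
    constructor
    · rintro ⟨b, hb⟩
      refine ⟨b ∅, fun u hu => ?_⟩
      rw [← hb {u} (by simpa using hu) (by simp [SimpleGraph.IsIndepSet]) (by simp),
        koszulDiff_one_singleton]
    · rintro ⟨a, ha⟩
      refine ⟨fun _ => a, fun B hB _ hcard => ?_⟩
      obtain ⟨u, rfl⟩ := Finset.card_eq_one.1 (by exact_mod_cast hcard)
      rw [koszulDiff_one_singleton, ha u (hB (by simp))]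
  simp only [hcocycle, hcobdry]
  constructor
  · rintro ⟨c, hc, hnc⟩
    push Not at hnc
    obtain ⟨a, ha⟩ : σ.Nonempty := by
      obtain ⟨u, hu, -⟩ := hnc 0
      exact ⟨u, hu⟩
    obtain ⟨b, hb, hab⟩ := hnc (c {a})
    have hadj : ∀ u ∈ σ, ∀ w ∈ σ, c {u} = c {a} → c {w} ≠ c {a} → G.Adj u w := by
      intro u hu w hw h1 h2
      by_contra hn
      refine h2 ?_
      rw [← h1]
      refine (hc u hu w hw ?_ hn).symm
      rintro rfl
      exact h2 h1
    -- The sides are the level set of c through a and its complement. Since c is constant along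
    -- non-edges, every cross pair is an edge of G.
    refine ⟨{ verts := Set.univ
              Adj := fun u w => (c {u.1} = c {a} ∧ c {w.1} ≠ c {a}) ∨
                (c {u.1} ≠ c {a} ∧ c {w.1} = c {a})
              adj_sub := ?_
              edge_vert := fun _ => Set.mem_univ _
              symm := ⟨?_⟩ }, fun _ => Set.mem_univ _, {u | c {u.1.1} = c {a}},
        {u | c {u.1.1} ≠ c {a}}, ⟨⟨⟨a, ha⟩, Set.mem_univ _⟩, rfl⟩,
        ⟨⟨⟨b, hb⟩, Set.mem_univ _⟩, hab⟩, ?_, ?_, ?_, ?_, ?_⟩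
    · rintro ⟨u, hu⟩ ⟨w, hw⟩ (⟨h1, h2⟩ | ⟨h1, h2⟩)
      · exact hadj u hu w hw h1 h2
      · exact (hadj w hw u hu h2 h1).symm
    · rintro u w (⟨h1, h2⟩ | ⟨h1, h2⟩)
      · exact Or.inr ⟨h2, h1⟩
      · exact Or.inl ⟨h2, h1⟩
    · exact Set.disjoint_left.2 fun u h1 h2 => h2 h1
    · exact Set.eq_univ_of_forall fun u => em _
    · rintro u hu w hw (h | h)
      · exact h.2 hw
      · exact h.1 hu
    · rintro u hu w hw (h | h)
      · exact hu h.1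
      · exact hw h.2
    · exact fun u hu w hw => Or.inl ⟨hu, hw⟩
  · classical
    rintro ⟨B, hB, V₁, V₂, ⟨a, ha⟩, ⟨b, hb⟩, hdisj, huniv, -, -, hadj⟩
    let side : V → Prop := fun u => ∃ h : u ∈ σ, (⟨⟨u, h⟩, hB _⟩ : B.verts) ∈ V₁
    have hside : ∀ u : B.verts, side u.1.1 ↔ u ∈ V₁ := by
      intro u
      constructor
      · rintro ⟨_, h⟩
        exact h
      · exact fun h => ⟨u.1.2, h⟩
    have h2 : ∀ u : B.verts, u ∉ V₁ → u ∈ V₂ := by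
      intro u hu
      have : u ∈ V₁ ∪ V₂ := huniv ▸ Set.mem_univ u
      exact this.resolve_left hu
    -- On singletons this is the indicator function of V₁, a non-constant cocycle.
    refine ⟨fun A => if ∃ u ∈ A, side u then 1 else 0, ?_, ?_⟩
    · intro u hu w hw _ hn
      have huw : side u ↔ side w := by
        have hu' := hside ⟨⟨u, hu⟩, hB _⟩
        have hw' := hside ⟨⟨w, hw⟩, hB _⟩
        simp only at hu' hw'
        rw [hu', hw']
        by_contra hne
        have hkey : ∀ x y : B.verts, x ∈ V₁ → y ∉ V₁ → G.Adj x.1.1 y.1.1 := fun x y hx hy =>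
          B.adj_sub (hadj x hx y (h2 y hy))
        by_cases hx : (⟨⟨u, hu⟩, hB _⟩ : B.verts) ∈ V₁ <;>
          by_cases hy : (⟨⟨w, hw⟩, hB _⟩ : B.verts) ∈ V₁
        · exact hne ⟨fun _ => hy, fun _ => hx⟩
        · exact hn (hkey _ _ hx hy)
        · exact hn (hkey _ _ hy hx).symm
        · exact hne ⟨fun h => absurd h hx, fun h => absurd h hy⟩
      simp [huw]
    · rintro ⟨x, hx⟩
      have h1 := hx a.1.1 a.1.2
      have h3 := hx b.1.1 b.1.2
      have hb1 : b ∉ V₁ := fun h => Set.disjoint_left.1 hdisj h hb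
      simp only [Finset.mem_singleton, exists_eq_left, hside, ha, hb1, if_true, if_false] at h1 h3
      exact zero_ne_one (h3.trans h1.symm)

/-! ### Chordal graphs and simplicial vertices -/

namespace SimpleGraph

variable {V : Type*}

/-- The edges of `H` with both ends in `s`. -/
def withinSet (H : SimpleGraph V) (s : Set V) : SimpleGraph V where
  Adj u v := H.Adj u v ∧ u ∈ s ∧ v ∈ s
  symm := ⟨fun _ _ h => ⟨h.1.symm, h.2.2, h.2.1⟩⟩
  loopless := ⟨fun u h => H.loopless.irrefl u h.1⟩

theorem withinSet_mono (H : SimpleGraph V) {s t : Set V} (h : s ⊆ t) :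
    H.withinSet s ≤ H.withinSet t :=
  fun _ _ huv => ⟨huv.1, h huv.2.1, h huv.2.2⟩

theorem withinSet_le (H : SimpleGraph V) (s : Set V) : H.withinSet s ≤ H :=
  fun _ _ huv => huv.1

theorem mem_of_mem_support_withinSet {H : SimpleGraph V} {s : Set V} {a b : V}
    (p : (H.withinSet s).Walk a b) (ha : a ∈ s) {u : V} (hu : u ∈ p.support) : u ∈ s := by
  induction p with
  | nil =>
    rw [Walk.support_nil, List.mem_singleton] at hu
    rwa [hu]
  | cons h p ih =>
    rw [Walk.support_cons, List.mem_cons] at hu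
    rcases hu with rfl | hu
    · exact ha
    · exact ih h.2.2 hu

/-- A geodesic is an induced path: a chord would give a shortcut. -/
theorem Walk.mem_edges_of_length_eq_dist {W : SimpleGraph V} {a b : V} (p : W.Walk a b)
    (hp : p.length = W.dist a b) {u w : V} (hu : u ∈ p.support) (hw : w ∈ p.support)
    (huw : W.Adj u w) : s(u, w) ∈ p.edges := by
  have key : ∀ i j : ℕ, i < j → j ≤ p.length → W.Adj (p.getVert i) (p.getVert j) →
      s(p.getVert i, p.getVert j) ∈ p.edges := by
    intro i j hij hj hadj
    have h := dist_le (((p.take i).concat hadj).append (p.drop j))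
    rw [Walk.length_append, Walk.length_concat, Walk.take_length, Walk.drop_length, ← hp] at h
    have hji : j = i + 1 := by
      rw [min_eq_left (by omega)] at h
      omega
    subst hji
    rw [Walk.mk_mem_edges_iff_exists]
    exact ⟨i, by omega, rfl⟩
  obtain ⟨i, rfl, hi⟩ := Walk.mem_support_iff_exists_getVert.1 hu
  obtain ⟨j, rfl, hj⟩ := Walk.mem_support_iff_exists_getVert.1 hw
  rcases lt_trichotomy i j with h | h | h
  · exact key i j h hj huw
  · subst h
    exact absurd huw (W.loopless.irrefl _)
  · rw [Sym2.eq_swap]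
    exact key j i h hi huw.symm

/-- Otherwise a shortest path from a to b within C ∪ {a, b}, closed up through d, is a cycle of
length at least 4. It has no chord, since the path is induced and d has no neighbour in C. -/
theorem IsChordalGraph.adj_of_common_neighbor {H : SimpleGraph V} (hH : H.IsChordalGraph)
    {C : Set V} (hC : ∀ x ∈ C, ∀ y ∈ C, (H.withinSet C).Reachable x y) {d a b : V} (hdC : d ∉ C)
    (hd : ∀ c ∈ C, ¬ H.Adj d c) (hda : H.Adj d a) (hdb : H.Adj d b) (hab : a ≠ b)
    (ha : ∃ c ∈ C, H.Adj c a) (hb : ∃ c ∈ C, H.Adj c b) : H.Adj a b := by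
  by_contra hnab
  set s : Set V := C ∪ {a, b} with hs
  have has : a ∈ s := Or.inr (Or.inl rfl)
  have hbs : b ∈ s := Or.inr (Or.inr rfl)
  obtain ⟨c₁, hc₁, hac₁⟩ := ha
  obtain ⟨c₂, hc₂, hbc₂⟩ := hb
  have hreach : (H.withinSet s).Reachable a b := by
    have h1 : (H.withinSet s).Adj a c₁ := ⟨hac₁.symm, has, Or.inl hc₁⟩
    have h2 : (H.withinSet s).Adj c₂ b := ⟨hbc₂, Or.inl hc₂, hbs⟩
    exact (h1.reachable.trans
      ((hC c₁ hc₁ c₂ hc₂).mono (H.withinSet_mono Set.subset_union_left))).trans h2.reachable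
  obtain ⟨p, hp, hpl⟩ := hreach.exists_path_of_dist
  have hlen : 2 ≤ p.length := by
    by_contra hlt
    have : p.length = 0 ∨ p.length = 1 := by omega
    rcases this with h | h
    · exact hab (Walk.eq_of_length_eq_zero h)
    · exact hnab (Walk.adj_of_length_eq_one h).1
  have hsupp : ∀ u ∈ p.support, u ∈ s := fun u hu => mem_of_mem_support_withinSet p has hu
  have hds : d ∉ s := by
    rintro (h | rfl | rfl)
    · exact hdC h
    · exact H.loopless.irrefl _ hda
    · exact H.loopless.irrefl _ hdb
  have hdp : d ∉ p.support := fun h => hds (hsupp d h)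
  have hdadj : ∀ w ∈ p.support, H.Adj d w → w = a ∨ w = b := by
    intro w hw hdw
    rcases hsupp w hw with h | h | h
    · exact absurd hdw (hd w h)
    · exact Or.inl h
    · exact Or.inr h
  set q : H.Walk d d := Walk.cons hda ((p.mapLe (H.withinSet_le s)).concat hdb.symm) with hq
  have hqc : q.IsCycle := by
    rw [hq, Walk.cons_isCycle_iff, Walk.concat_isPath_iff]
    refine ⟨⟨hp.mapLe _, by rwa [Walk.support_mapLe_eq_support]⟩, ?_⟩
    rw [Walk.edges_concat, List.concat_eq_append, List.mem_append, Walk.edges_mapLe_eq_edges]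
    rintro (h | h)
    · exact hdp (Walk.fst_mem_support_of_mem_edges p h)
    · rw [List.mem_singleton, Sym2.eq_iff] at h
      rcases h with ⟨h1, h2⟩ | ⟨-, h2⟩
      · exact hab (h2.trans h1)
      · exact hab h2
  have hmem : ∀ u, u ∈ q.support ↔ u = d ∨ u ∈ p.support := by
    intro u
    rw [hq, Walk.support_cons, Walk.support_concat, Walk.support_mapLe_eq_support]
    simp only [List.mem_cons, List.mem_append, List.not_mem_nil, or_false]
    tauto
  have hedge : ∀ e, e ∈ q.edges ↔ e = s(d, a) ∨ e ∈ p.edges ∨ e = s(b, d) := by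
    intro e
    rw [hq, Walk.edges_cons, Walk.edges_concat, Walk.edges_mapLe_eq_edges]
    simp
  obtain ⟨u, hu, w, hw, huw, hne⟩ := hH d q hqc (by
    rw [hq, Walk.length_cons, Walk.length_concat, Walk.length_mapLe]
    omega)
  rw [hmem] at hu hw
  refine hne ((hedge _).2 ?_)
  rcases hu with rfl | hu <;> rcases hw with rfl | hw
  · exact absurd huw (H.loopless.irrefl _)
  · rcases hdadj w hw huw with rfl | rfl
    · exact Or.inl rfl
    · exact Or.inr (Or.inr Sym2.eq_swap)
  · rcases hdadj u hu huw.symm with rfl | rfl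
    · exact Or.inl Sym2.eq_swap
    · exact Or.inr (Or.inr rfl)
  · exact Or.inr (Or.inl (p.mem_edges_of_length_eq_dist hpl hu hw ⟨huw, hsupp u hu, hsupp w hw⟩))

/-- Dirac's theorem: a chordal graph has a simplicial vertex, and so has every induced subgraph. -/
theorem IsChordalGraph.exists_simplicial {H : SimpleGraph V} (hH : H.IsChordalGraph)
    (σ : Finset V) (hσ : σ.Nonempty) :
    ∃ v ∈ σ, ∀ u ∈ σ, ∀ w ∈ σ, H.Adj v u → H.Adj v w → u ≠ w → H.Adj u w := by
  classical
  induction σ using Finset.strongInduction with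
  | H σ ih =>
    by_cases hcomplete : ∀ u ∈ σ, ∀ w ∈ σ, u ≠ w → H.Adj u w
    · obtain ⟨v, hv⟩ := hσ
      exact ⟨v, hv, fun u hu w hw _ _ huw => hcomplete u hu w hw huw⟩
    push Not at hcomplete
    obtain ⟨u₀, hu₀, w₀, hw₀, hne, hnadj⟩ := hcomplete
    -- Choose C ⊆ σ connected, with some vertex of σ outside C and not adjacent to C, and of largest
    -- size. The simplicial vertex is sought among the vertices D of σ away from C and its
    -- neighbours.
    set S : Finset (Finset V) := σ.powerset.filter fun C => C.Nonempty ∧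
      (∀ x ∈ C, ∀ y ∈ C, (H.withinSet (C : Set V)).Reachable x y) ∧
        ∃ d ∈ σ, d ∉ C ∧ ∀ c ∈ C, ¬ H.Adj d c with hS
    have hSne : S.Nonempty := by
      refine ⟨{u₀}, ?_⟩
      rw [hS, Finset.mem_filter, Finset.mem_powerset, Finset.singleton_subset_iff]
      refine ⟨hu₀, Finset.singleton_nonempty _, fun x hx y hy => ?_, w₀, hw₀, ?_, ?_⟩
      · rw [Finset.mem_singleton] at hx hy
        rw [hx, hy]
      · simpa using hne.symm
      · intro c hc
        rw [Finset.mem_singleton] at hc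
        rw [hc]
        exact fun h => hnadj h.symm
    obtain ⟨C, hCS, hmax⟩ := Finset.exists_max_image S Finset.card hSne
    rw [hS, Finset.mem_filter, Finset.mem_powerset] at hCS
    obtain ⟨hCσ, ⟨c₀, hc₀⟩, hCconn, d₀, hd₀σ, hd₀C, hd₀⟩ := hCS
    set D : Finset V := σ.filter fun d => d ∉ C ∧ ∀ c ∈ C, ¬ H.Adj d c with hD
    have hmemD : ∀ x, x ∈ D ↔ x ∈ σ ∧ x ∉ C ∧ ∀ c ∈ C, ¬ H.Adj x c := fun x => by
      rw [hD, Finset.mem_filter]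
    have hDσ : D ⊂ σ := by
      refine (Finset.ssubset_iff_of_subset (Finset.filter_subset _ _)).2 ⟨c₀, hCσ hc₀, fun h => ?_⟩
      exact ((hmemD c₀).1 h).2.1 hc₀
    obtain ⟨v, hvD, hv⟩ := ih D hDσ ⟨d₀, (hmemD d₀).2 ⟨hd₀σ, hd₀C, hd₀⟩⟩
    -- If d ∈ D missed a neighbour x of C, then C ∪ {x} would be a larger admissible set, still
    -- avoided by d.
    have hjoin : ∀ x ∈ σ, x ∉ C → (∃ c ∈ C, H.Adj c x) → ∀ d ∈ D, H.Adj d x := by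
      intro x hxσ hxC ⟨c, hc, hcx⟩ d hdD
      obtain ⟨hdσ, hdC, hd⟩ := (hmemD d).1 hdD
      by_contra hdx
      have hmem : insert x C ∈ S := by
        rw [hS, Finset.mem_filter, Finset.mem_powerset]
        have hsub : (C : Set V) ⊆ ((insert x C : Finset V) : Set V) := by
          exact_mod_cast Finset.subset_insert x C
        have hadj : (H.withinSet ((insert x C : Finset V) : Set V)).Adj c x :=
          ⟨hcx, hsub hc, by simp⟩
        have hreach : ∀ y ∈ insert x C,
            (H.withinSet ((insert x C : Finset V) : Set V)).Reachable c y := by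
          intro y hy
          rcases Finset.mem_insert.1 hy with rfl | hy
          · exact hadj.reachable
          · exact (hCconn c hc y hy).mono (H.withinSet_mono hsub)
        refine ⟨Finset.insert_subset hxσ hCσ, Finset.insert_nonempty _ _,
          fun y hy z hz => (hreach y hy).symm.trans (hreach z hz), d, hdσ, ?_, ?_⟩
        · rw [Finset.mem_insert, not_or]
          refine ⟨?_, hdC⟩
          rintro rfl
          exact hd c hc hcx.symm
        · intro y hy
          rcases Finset.mem_insert.1 hy with rfl | hy
          · exact hdx
          · exact hd y hy
      have := hmax _ hmem
      rw [Finset.card_insert_of_notMem hxC] at this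
      omega
    obtain ⟨hvσ, hvC, hvnadj⟩ := (hmemD v).1 hvD
    have hcases : ∀ x ∈ σ, H.Adj v x → x ∈ D ∨ (x ∉ C ∧ ∃ c ∈ C, H.Adj c x) := by
      intro x hx hvx
      have hxC : x ∉ C := fun h => hvnadj x h hvx
      by_cases h : ∃ c ∈ C, H.Adj c x
      · exact Or.inr ⟨hxC, h⟩
      · refine Or.inl ((hmemD x).2 ⟨hx, hxC, fun c hc hxc => h ⟨c, hc, hxc.symm⟩⟩)
    refine ⟨v, hvσ, fun u hu w hw hvu hvw huw => ?_⟩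
    rcases hcases u hu hvu with huD | ⟨huC, huN⟩ <;> rcases hcases w hw hvw with hwD | ⟨hwC, hwN⟩
    · exact hv u huD w hwD hvu hvw huw
    · exact hjoin w hw hwC hwN u huD
    · exact (hjoin u hu huC huN w hwD).symm
    · exact hH.adj_of_common_neighbor (C := (C : Set V)) (fun x hx y hy => hCconn x hx y hy)
        (fun h => hvC h) (fun c hc => hvnadj c hc) hvu hvw huw huN hwN

end SimpleGraph

/-! ### Betti numbers for co-chordal graphs -/

theorem MinimalGradedFreeResolution.betti_zeroOneVector_ne_zero_iff {K : Type*} [Field K]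
    {V : Type*} [Finite V] {G : SimpleGraph V} (hG : G.IsCoChordalGraph)
    (F : MinimalGradedFreeResolution K (quotientPiece K (edgeIdeal K G))) (i : ℕ) (hi : 1 ≤ i)
    (σ : Finset V) : F.betti i (zeroOneVector σ) ≠ 0 ↔ σ.card = i + 1 ∧
      (G.induce (σ : Set V)).HasCompleteBipartiteSpanningSubgraph := by
  obtain ⟨N, ⟨e⟩⟩ := Finite.exists_equiv_fin V
  -- An arbitrary order, needed only for the signs.
  let _ : LinearOrder V := LinearOrder.lift' e e.injective
  obtain ⟨i, rfl⟩ : ∃ k, i = k + 1 := ⟨i - 1, by omega⟩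
  rw [F.betti_ne_zero_iff, hasKoszulCohomology_edgeIdeal_iff]
  by_cases h1 : (σ.card : ℤ) - (i + 1 : ℕ) = 1
  · have h2 : σ.card = i + 1 + 1 := by omega
    rw [h1, hasCompleteBipartiteSpanningSubgraph_iff]
    exact ⟨fun h => ⟨h2, h⟩, fun h => h.2⟩
  · refine iff_of_false ?_ fun h => h1 (by omega)
    rintro ⟨c, hc, hnb⟩
    refine hnb ?_
    rcases lt_or_ge ((σ.card : ℤ) - (i + 1 : ℕ)) 2 with hlt | hge
    -- Degree at most 0: only B = ∅ can occur, in degree 0. Then σ is nonempty, and the cocycle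
    -- condition at a singleton gives c ∅ = 0.
    · refine ⟨0, fun B hB hi hBn => ?_⟩
      have hB0 : B = ∅ := Finset.card_eq_zero.1 (by omega)
      subst hB0
      obtain ⟨u, hu⟩ : σ.Nonempty := Finset.card_pos.1 (by simp at hBn; omega)
      have := hc {u} (by simpa using hu) (by simp [SimpleGraph.IsIndepSet])
        (by simp at hBn ⊢; omega)
      rw [koszulDiff_one_singleton] at this
      rw [this]
      simp [koszulDiff]
    · obtain ⟨n, hn⟩ : ∃ n : ℕ, (σ.card : ℤ) - (i + 1 : ℕ) = n :=
        ⟨_, (Int.toNat_of_nonneg (by omega)).symm⟩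
      rw [hn] at hc hge ⊢
      have helim : ∀ τ : Finset V, τ.Nonempty → ∃ v ∈ τ, ∀ u ∈ τ, ∀ w ∈ τ, u ≠ v → w ≠ v → u ≠ w →
          ¬ G.Adj v u → ¬ G.Adj v w → ¬ G.Adj u w := by
        intro τ hτ
        obtain ⟨v, hv, hsimp⟩ := SimpleGraph.IsChordalGraph.exists_simplicial hG τ hτ
        refine ⟨v, hv, fun u hu w hw huv hwv huw hvu hvw => ?_⟩
        exact ((SimpleGraph.compl_adj G u w).1 (hsimp u hu w hw
          ((SimpleGraph.compl_adj G v u).2 ⟨huv.symm, hvu⟩)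
          ((SimpleGraph.compl_adj G v w).2 ⟨hwv.symm, hvw⟩) huw)).2
      obtain ⟨b, hb⟩ := exists_koszulDiff_eq_of_simplicial G helim (n := n) (by omega) σ c
        (fun B hB hi hBn => hc B hB hi (by omega))
      exact ⟨b, fun B hB hi hBn => hb B hB hi (by omega)⟩

/-! ### Existence of a minimal graded free resolution -/

theorem IsGradedProjection.mem_of_forall_mem {K ι M : Type*} [Field K] [AddCommGroup M]
    [Module K M] {𝓜 : ι → Submodule K M} {p : ι → M →ₗ[K] M} (hp : IsGradedProjection 𝓜 p)
    (N : Submodule K M) (m : M) (h : ∀ τ, p τ m ∈ N) : m ∈ N := by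
  classical
  have hm : m ∈ ⨆ τ, 𝓜 τ := hp.iSup_eq_top ▸ Submodule.mem_top
  obtain ⟨f, hf, rfl⟩ := (Submodule.mem_iSup_iff_exists_finsupp _ _).1 hm
  have key : ∀ τ, p τ (f.sum fun _ x => x) = f τ := by
    intro τ
    rw [Finsupp.sum, map_sum]
    by_cases hτ : τ ∈ f.support
    · rw [Finset.sum_eq_single τ, hp.self _ _ (hf τ)]
      · exact fun τ' _ h => hp.ne τ τ' h _ (hf τ')
      · exact fun h => absurd hτ h
    · rw [Finsupp.notMem_support_iff.1 hτ]
      refine Finset.sum_eq_zero fun τ' h' => hp.ne τ τ' ?_ _ (hf τ')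
      rintro rfl
      exact hτ h'
  refine sum_mem fun τ _ => ?_
  have := h τ
  rwa [key] at this

section cover

variable {K : Type*} [Field K] {V : Type*} {M : Type*} [AddCommGroup M] [Module K M]
  [Module (MvPolynomial V K) M] [IsScalarTower K (MvPolynomial V K) M]

theorem C_smul_eq (c : K) (m : M) : (C c : MvPolynomial V K) • m = c • m := by
  rw [← algebraMap_eq, algebraMap_smul]

theorem monomial_smul_mem {W : (V →₀ ℕ) → Submodule K M}
    (hW : ∀ τ v, ∀ m ∈ W τ, (X v : MvPolynomial V K) • m ∈ W (Finsupp.single v 1 + τ))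
    (k : V →₀ ℕ) (c : K) {τ : V →₀ ℕ} {m : M} (hm : m ∈ W τ) :
    (monomial k c : MvPolynomial V K) • m ∈ W (k + τ) := by
  classical
  induction h : k.degree generalizing k with
  | zero =>
    rw [Finsupp.degree_eq_zero_iff] at h
    subst h
    rw [← C_apply, C_smul_eq, zero_add]
    exact (W τ).smul_mem c hm
  | succ n ih =>
    obtain ⟨v, hv⟩ : ∃ v, k v ≠ 0 := by
      by_contra hne
      push Not at hne
      have : k = 0 := Finsupp.ext hne
      simp [this] at h
    obtain ⟨k', rfl⟩ : ∃ k', k = Finsupp.single v 1 + k' :=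
      ⟨k - Finsupp.single v 1, (add_tsub_cancel_of_le (Finsupp.single_le_iff.2 (by omega))).symm⟩
    have h' : k'.degree = n := by
      rw [map_add, Finsupp.degree_single] at h
      omega
    have : (monomial (Finsupp.single v 1 + k') c : MvPolynomial V K) = X v * monomial k' c := by
      rw [X, monomial_mul, one_mul]
    rw [this, mul_smul, add_assoc]
    exact hW _ v _ (ih k' h')

/-- The piece of degree `τ` of `𝔪 N`, where `W` are the pieces of `N`. -/
def maximalIdealPiece (W : (V →₀ ℕ) → Submodule K M) (τ : V →₀ ℕ) : Submodule K M :=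
  Submodule.span K {m | ∃ (v : V) (τ' : V →₀ ℕ), Finsupp.single v 1 + τ' = τ ∧
    ∃ w ∈ W τ', (X v : MvPolynomial V K) • w = m}

theorem monomial_smul_mem_maximalIdealPiece {W : (V →₀ ℕ) → Submodule K M}
    (hW : ∀ τ v, ∀ m ∈ W τ, (X v : MvPolynomial V K) • m ∈ W (Finsupp.single v 1 + τ))
    {k : V →₀ ℕ} (hk : k ≠ 0) (c : K) {τ : V →₀ ℕ} {m : M} (hm : m ∈ W τ) :
    (monomial k c : MvPolynomial V K) • m ∈ maximalIdealPiece W (k + τ) := by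
  obtain ⟨v, hv⟩ : ∃ v, k v ≠ 0 := by
    by_contra hne
    push Not at hne
    exact hk (Finsupp.ext hne)
  obtain ⟨k', rfl⟩ : ∃ k', k = Finsupp.single v 1 + k' :=
    ⟨k - Finsupp.single v 1, (add_tsub_cancel_of_le (Finsupp.single_le_iff.2 (by omega))).symm⟩
  have : (monomial (Finsupp.single v 1 + k') c : MvPolynomial V K) = X v * monomial k' c := by
    rw [X, monomial_mul, one_mul]
  rw [this, mul_smul, add_assoc]
  exact Submodule.subset_span ⟨v, k' + τ, rfl, _, monomial_smul_mem hW k' c hm, rfl⟩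

/-- The minimal graded free cover of a graded submodule `N`. -/
theorem exists_minimal_cover {𝓜 : (V →₀ ℕ) → Submodule K M} {p : (V →₀ ℕ) → M →ₗ[K] M}
    (hp : IsGradedProjection 𝓜 p)
    (hX : ∀ τ v, ∀ m ∈ 𝓜 τ, (X v : MvPolynomial V K) • m ∈ 𝓜 (Finsupp.single v 1 + τ))
    (hfin : ∀ τ, FiniteDimensional K (𝓜 τ)) (N : Submodule (MvPolynomial V K) M)
    (hN : ∀ τ, ∀ n ∈ N, p τ n ∈ N) :
    ∃ (β : (V →₀ ℕ) → ℕ) (φ : ShiftedFree K β →ₗ[MvPolynomial V K] M),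
      (∀ τ, ∀ f ∈ shiftedFreePiece K β τ, φ f ∈ 𝓜 τ) ∧ LinearMap.range φ = N ∧
        ∀ f, φ f = 0 → ∀ j, constantCoeff (f j) = 0 := by
  classical
  set W : (V →₀ ℕ) → Submodule K M := fun τ => 𝓜 τ ⊓ N.restrictScalars K with hWdef
  have hW : ∀ τ v, ∀ m ∈ W τ, (X v : MvPolynomial V K) • m ∈ W (Finsupp.single v 1 + τ) :=
    fun τ v m hm => ⟨hX τ v m hm.1, N.smul_mem _ hm.2⟩
  have hU : ∀ τ, maximalIdealPiece W τ ≤ W τ := by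
    intro τ
    refine Submodule.span_le.2 ?_
    rintro _ ⟨v, τ', rfl, w, hw, rfl⟩
    exact hW τ' v w hw
  -- C τ is a complement of (𝔪N)_τ in N_τ; a basis of it supplies the minimal generators of degree
  -- τ. Finite-dimensional pieces keep each β τ finite.
  have hC : ∀ τ, ∃ C : Submodule K M, maximalIdealPiece W τ ⊓ C = ⊥ ∧
      maximalIdealPiece W τ ⊔ C = W τ := by
    intro τ
    obtain ⟨C', hC'⟩ := exists_isCompl (maximalIdealPiece W τ)
    refine ⟨C' ⊓ W τ, ?_, ?_⟩
    · rw [← inf_assoc, hC'.inf_eq_bot, bot_inf_eq]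
    · rw [← sup_inf_assoc_of_le C' (hU τ), hC'.sup_eq_top, top_inf_eq]
  choose C hC1 hC2 using hC
  have hCW : ∀ τ, C τ ≤ W τ := fun τ => hC2 τ ▸ le_sup_right
  have hCfin : ∀ τ, FiniteDimensional K (C τ) := fun τ =>
    Submodule.finiteDimensional_of_le ((hCW τ).trans inf_le_left)
  let b : ∀ τ, Module.Basis (Fin (Module.finrank K (C τ))) K (C τ) := fun τ =>
    Module.finBasis K (C τ)
  let β : (V →₀ ℕ) → ℕ := fun τ => Module.finrank K (C τ)
  let e : (Σ σ : V →₀ ℕ, Fin (β σ)) → M := fun j => (b j.1 j.2 : M)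
  have he : ∀ j, e j ∈ W j.1 := fun j => hCW _ (b j.1 j.2).2
  let φ : ShiftedFree K β →ₗ[MvPolynomial V K] M := Finsupp.linearCombination _ e
  have hφs : ∀ j q, φ (Finsupp.single j q) = q • e j := fun j q =>
    Finsupp.linearCombination_single _ _ _
  have hφsum : ∀ f, φ f = ∑ j ∈ f.support, f j • e j := fun f =>
    Finsupp.linearCombination_apply _ _
  have hpiece : ∀ τ, ∀ f ∈ shiftedFreePiece K β τ, ∀ j ∈ f.support,
      j.1 ≤ τ ∧ f j = monomial (τ - j.1) (coeff (τ - j.1) (f j)) := by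
    intro τ f hf j hj
    have h := (isGradedProjection_shiftedFreeProj β).self τ f hf
    by_cases hle : j.1 ≤ τ
    · refine ⟨hle, ?_⟩
      conv_lhs => rw [← h]
      exact shiftedFreeProj_apply_of_le f hle
    · rw [Finsupp.mem_support_iff, ← h, shiftedFreeProj_apply_of_not_le f hle] at hj
      exact absurd rfl hj
  have hgraded : ∀ τ, ∀ f ∈ shiftedFreePiece K β τ, φ f ∈ 𝓜 τ := by
    intro τ f hf
    rw [hφsum]
    refine sum_mem fun j hj => ?_
    obtain ⟨hle, heq⟩ := hpiece τ f hf j hj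
    rw [heq]
    have := monomial_smul_mem hX (τ - j.1) (coeff (τ - j.1) (f j)) (he j).1
    rwa [tsub_add_cancel_of_le hle] at this
  -- Graded Nakayama, by induction on the total degree of τ.
  have hrange : ∀ τ, W τ ≤ (LinearMap.range φ).restrictScalars K := by
    intro τ
    induction h : τ.degree using Nat.strong_induction_on generalizing τ with
    | _ n ih =>
      rw [← hC2 τ]
      refine sup_le (Submodule.span_le.2 ?_) fun c hc => ?_
      · rintro _ ⟨v, τ', rfl, w, hw, rfl⟩
        refine Submodule.smul_mem (LinearMap.range φ) _ (ih τ'.degree ?_ τ' rfl hw)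
        rw [map_add, Finsupp.degree_single] at h
        omega
      · have := congrArg (Subtype.val) ((b τ).sum_repr ⟨c, hc⟩)
        change _ = c at this
        rw [← this, Submodule.coe_sum]
        refine sum_mem fun k _ => ?_
        rw [Submodule.coe_smul]
        refine Submodule.smul_mem _ _ ⟨Finsupp.single ⟨τ, k⟩ 1, ?_⟩
        rw [hφs, one_smul]
  refine ⟨β, φ, hgraded, le_antisymm ?_ ?_, ?_⟩
  · rintro _ ⟨f, rfl⟩
    rw [hφsum]
    exact sum_mem fun j _ => N.smul_mem _ (he j).2
  · intro n hn
    exact hp.mem_of_forall_mem ((LinearMap.range φ).restrictScalars K) n fun τ =>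
      hrange τ ⟨hp.mem τ n, hN τ n hn⟩
  · rintro f hf ⟨τ, k₀⟩
    -- The constant coefficients at the basis vectors of degree τ survive in the component g and
    -- make up `top`. The rest of g maps into 𝔪N, so φ top lies in both (𝔪N)_τ and C τ, is therefore
    -- zero, and the basis of C τ is independent.
    set g := shiftedFreeProj β τ f with hg
    have hgp : g ∈ shiftedFreePiece K β τ := (isGradedProjection_shiftedFreeProj β).mem τ f
    have hφg : φ g = 0 := by
      have := (isGradedProjection_shiftedFreeProj β).map_comm hp φ.toAddMonoidHom hgraded τ f
      change φ g = p τ (φ f) at this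
      rw [this, hf, map_zero]
    have hgτ : ∀ k, g ⟨τ, k⟩ = MvPolynomial.C (coeff 0 (f ⟨τ, k⟩)) := by
      intro k
      have := shiftedFreeProj_apply_of_le (τ := τ) f (j := ⟨τ, k⟩) le_rfl
      simpa using this
    set top : ShiftedFree K β :=
      ∑ k : Fin (β τ), Finsupp.single ⟨τ, k⟩ (MvPolynomial.C (coeff 0 (f ⟨τ, k⟩))) with htop
    have htopp : top ∈ shiftedFreePiece K β τ := by
      refine sum_mem fun k _ => ?_
      have := single_monomial_mem_shiftedFreePiece (K := K) (β := β) ⟨τ, k⟩ 0 (coeff 0 (f ⟨τ, k⟩))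
      rwa [zero_add] at this
    have htopτ : ∀ k, top ⟨τ, k⟩ = MvPolynomial.C (coeff 0 (f ⟨τ, k⟩)) := by
      intro k
      rw [htop, Finsupp.finsetSum_apply, Finset.sum_eq_single k]
      · rw [Finsupp.single_eq_same]
      · intro k' _ hk'
        rw [Finsupp.single_apply, if_neg]
        simpa using hk'
      · exact fun h => absurd (Finset.mem_univ k) h
    have hrest : φ (g - top) ∈ maximalIdealPiece W τ := by
      rw [hφsum]
      refine sum_mem fun j hj => ?_
      obtain ⟨hle, heq⟩ := hpiece τ _ (sub_mem hgp htopp) j hj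
      rw [heq]
      have hne : τ - j.1 ≠ 0 := by
        intro h0
        have hj1 : j.1 = τ := le_antisymm hle (tsub_eq_zero_iff_le.1 h0)
        obtain ⟨τ', k⟩ := j
        subst hj1
        rw [Finsupp.mem_support_iff, Finsupp.sub_apply, hgτ, htopτ, sub_self] at hj
        exact hj rfl
      have := monomial_smul_mem_maximalIdealPiece hW hne (coeff (τ - j.1) ((g - top) j)) (he j)
      rwa [tsub_add_cancel_of_le hle] at this
    have hφtop : φ top = ((∑ k, coeff 0 (f ⟨τ, k⟩) • b τ k : C τ) : M) := by
      rw [htop, map_sum, Submodule.coe_sum]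
      refine Finset.sum_congr rfl fun k _ => ?_
      rw [hφs, C_smul_eq, Submodule.coe_smul]
    have hzero : φ top = 0 := by
      rw [map_sub, hφg, zero_sub, neg_mem_iff] at hrest
      have : φ top ∈ maximalIdealPiece W τ ⊓ C τ := ⟨hrest, by
        rw [hφtop]
        exact Subtype.property _⟩
      rwa [hC1, Submodule.mem_bot] at this
    rw [hφtop, Submodule.coe_eq_zero] at hzero
    exact Fintype.linearIndependent_iff.1 (b τ).linearIndependent _ hzero k₀

end cover

section finiteness

variable {K : Type*} [Field K] {V : Type*}

theorem finiteDimensional_shiftedFreePiece (β : (V →₀ ℕ) → ℕ) (τ : V →₀ ℕ) :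
    FiniteDimensional K (shiftedFreePiece K β τ) := by
  classical
  have : Finite (Set.Iic τ) := (Set.finite_Iic τ).to_subtype
  let Φ : shiftedFreePiece K β τ →ₗ[K] ((Σ σ : Set.Iic τ, Fin (β σ)) → K) :=
    { toFun := fun f j => coeff (τ - j.1.1) (f.1 ⟨j.1.1, j.2⟩)
      map_add' := fun f g => by ext j; simp
      map_smul' := fun c f => by ext j; simp }
  refine Module.Finite.of_injective Φ ?_
  rintro ⟨f, hf⟩ ⟨g, hg⟩ h
  ext j m
  by_cases hm : m + j.1 = τ
  · have hle : j.1 ≤ τ := hm ▸ le_add_self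
    have := congrFun h ⟨⟨j.1, hle⟩, j.2⟩
    change coeff (τ - j.1) (f j) = coeff (τ - j.1) (g j) at this
    rwa [← hm, add_tsub_cancel_right] at this
  · exact (hf j m hm).trans (hg j m hm).symm

theorem X_smul_mem_shiftedFreePiece (β : (V →₀ ℕ) → ℕ) (τ : V →₀ ℕ) (v : V)
    (m : ShiftedFree K β) (hm : m ∈ shiftedFreePiece K β τ) :
    (X v : MvPolynomial V K) • m ∈ shiftedFreePiece K β (Finsupp.single v 1 + τ) := by
  classical
  intro j k hk
  rw [Finsupp.smul_apply, smul_eq_mul, coeff_X_mul']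
  split_ifs with h
  · refine hm j _ fun h1 => hk ?_
    rw [← h1, ← add_assoc]
    congr 1
    rw [add_comm]
    exact (Finsupp.sub_add_single_one_cancel (by simpa using h)).symm
  · rfl

theorem X_smul_mem_quotientPiece (I : Ideal (MvPolynomial V K)) (τ : V →₀ ℕ) (v : V)
    (m : MvPolynomial V K ⧸ I) (hm : m ∈ quotientPiece K I τ) :
    (X v : MvPolynomial V K) • m ∈ quotientPiece K I (Finsupp.single v 1 + τ) := by
  obtain ⟨c, rfl⟩ := mem_quotientPiece_iff.1 hm
  refine mem_quotientPiece_iff.2 ⟨c, ?_⟩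
  change _ = Ideal.Quotient.mk I (X v * monomial τ c)
  rw [X, monomial_mul, one_mul]

theorem finiteDimensional_quotientPiece (I : Ideal (MvPolynomial V K)) (τ : V →₀ ℕ) :
    FiniteDimensional K (quotientPiece K I τ) := by
  unfold quotientPiece
  infer_instance

/-- Existence of a minimal graded free resolution of `S / I(G)`. -/
theorem nonempty_minimalGradedFreeResolution (G : SimpleGraph V) :
    Nonempty (MinimalGradedFreeResolution K (quotientPiece K (edgeIdeal K G))) := by
  obtain ⟨β₀, ε, hε, hεr, hεm⟩ := exists_minimal_cover (isGradedProjection_edgeIdealProj (K := K) G)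
    (X_smul_mem_quotientPiece _) (finiteDimensional_quotientPiece _) ⊤ fun _ _ _ => trivial
  -- A stage is a graded free module with a graded submodule of 𝔪F, namely the kernel to be covered
  -- next.
  let Stage := Σ β : (V →₀ ℕ) → ℕ, {N : Submodule (MvPolynomial V K) (ShiftedFree K β) //
    (∀ τ, ∀ f ∈ N, shiftedFreeProj β τ f ∈ N) ∧ ∀ f ∈ N, ∀ j, constantCoeff (f j) = 0}
  have H : ∀ s : Stage, ∃ (β : (V →₀ ℕ) → ℕ)
      (φ : ShiftedFree K β →ₗ[MvPolynomial V K] ShiftedFree K s.1),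
      (∀ τ, ∀ f ∈ shiftedFreePiece K β τ, φ f ∈ shiftedFreePiece K s.1 τ) ∧
        LinearMap.range φ = s.2.1 ∧ ∀ f, φ f = 0 → ∀ j, constantCoeff (f j) = 0 := fun s =>
    exists_minimal_cover (isGradedProjection_shiftedFreeProj s.1) (X_smul_mem_shiftedFreePiece s.1)
      (finiteDimensional_shiftedFreePiece s.1) s.2.1 s.2.2.1
  choose β φ hφ hr hm using H
  have hker : ∀ {β : (V →₀ ℕ) → ℕ} {M : Type _} [AddCommGroup M] [Module K M]
      [Module (MvPolynomial V K) M] {𝓜 : (V →₀ ℕ) → Submodule K M} {p : (V →₀ ℕ) → M →ₗ[K] M}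
      (_ : IsGradedProjection 𝓜 p) (ψ : ShiftedFree K β →ₗ[MvPolynomial V K] M)
      (_ : ∀ τ, ∀ f ∈ shiftedFreePiece K β τ, ψ f ∈ 𝓜 τ) (τ : V →₀ ℕ),
      ∀ f ∈ LinearMap.ker ψ, shiftedFreeProj β τ f ∈ LinearMap.ker ψ := by
    intro β M _ _ _ 𝓜 p hp ψ hψ τ f hf
    have := (isGradedProjection_shiftedFreeProj β).map_comm hp ψ.toAddMonoidHom hψ τ f
    change ψ (shiftedFreeProj β τ f) = p τ (ψ f) at this
    rw [LinearMap.mem_ker] at hf ⊢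
    rw [this, hf, map_zero]
  let s₀ : Stage := ⟨β₀, LinearMap.ker ε,
    hker (isGradedProjection_edgeIdealProj (K := K) G) ε hε, hεm⟩
  let next : Stage → Stage := fun s => ⟨β s, LinearMap.ker (φ s),
    hker (isGradedProjection_shiftedFreeProj s.1) (φ s) (hφ s), hm s⟩
  let st : ℕ → Stage := fun n => Nat.rec s₀ (fun _ s => next s) n
  exact ⟨{ betti := fun i => (st i).1
           d := fun i => φ (st i)
           ε := ε
           d_graded := fun i => hφ (st i)
           ε_graded := hε
           ε_surjective := LinearMap.range_eq_top.1 hεr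
           exact_zero := LinearMap.exact_iff.2 (hr s₀).symm
           exact_succ := fun i => LinearMap.exact_iff.2 (hr (st (i + 1))).symm
           minimal := fun i f => (st i).2.2.2 _ (hr (st i) ▸ LinearMap.mem_range_self _ f) }⟩

end finiteness

theorem corollary5p2 (K : Type*) [Field K] {V : Type*} [Finite V] (G : SimpleGraph V)
    (hG : G.IsCoChordalGraph) :
    Nonempty (MinimalGradedFreeResolution K (quotientPiece K (edgeIdeal K G))) ∧
      ∀ F : MinimalGradedFreeResolution K (quotientPiece K (edgeIdeal K G)),
        ∀ i : ℕ, 1 ≤ i → ∀ σ : Finset V,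
          F.betti i (zeroOneVector σ) ≠ 0 ↔
            σ.card = i + 1 ∧
              (G.induce (σ : Set V)).HasCompleteBipartiteSpanningSubgraph :=
  ⟨nonempty_minimalGradedFreeResolution G, fun F i hi σ =>
    F.betti_zeroOneVector_ne_zero_iff hG i hi σ⟩
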